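/- For an integer $k\ge 1$ and a finite nonempty simple graph $G$ on $n$ vertices, the $k$-star density of $G$ is $t_k(G)=|\mathrm{Hom}(K_{1,k},G)|/n^{k+1}$, where $\mathrm{Hom}$ denotes the set of graph homomorphisms; the edge density is $t_1(G)$. The phase space of the edge/$k$-star model is the set $P_k\subset\mathbb R^2$ of accumulation points of the set of all pairs $(t_1(G),t_k(G))$, $G$ a finite nonempty simple graph. Put $$A_k(\varepsilon)=\bigl[1-\sqrt{1-\varepsilon}\bigr]\bigl[1+\sqrt{1-\varepsilon}\,(1-\sqrt{1-\varepsilon})^{k-1}\bigr],\qquad C_k(\varepsilon)=\varepsilon^{(k+1)/2}.$$ Corollary. Let $2\le k\le 30$. There is exactly one point $\varepsilon_0\in(0,1)$ at which $A_k(\varepsilon_0)=C_k(\varepsilon_0)$, and for every $\varepsilon\in[0,1]$ the set $\{\tau:(\varepsilon,\tau)\in P_k\}$ has a greatest element (the upper boundary of the phase space), equal to $$\tau=\begin{cases}A_k(\varepsilon), & \varepsilon\le\varepsilon_0,\\ C_k(\varepsilon), & \varepsilon\ge\varepsilon_0.\end{cases}$$ For $k=2$ one has $\varepsilon_0=1/2$,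 and for $k=3$ one has $\varepsilon_0=3/4$. Moreover, for every $\varepsilon\in[0,1]$ the set $\{\tau:(\varepsilon,\tau)\in P_k\}$ has a least element (the lower boundary), equal to $\varepsilon^k$. -/

import Mathlib

/-- The `k`-star density of a graph on `n` vertices: the number of graph homomorphisms from the
`k`-star (centre `0`, leaves `1, …, k`) into `G`, divided by the number `n ^ (k + 1)` of all vertex maps. The edge density is
the case `k = 1`. -/
noncomputable def starDensity (k : ℕ) {n : ℕ} (G : SimpleGraph (Fin n)) : ℝ :=
  (Nat.card (SimpleGraph.starGraph (0 : Fin (k + 1)) →g G) : ℝ) / (n : ℝ) ^ (k + 1)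

/-- The set of pairs (edge density, `k`-star density) of finite nonempty simple graphs. -/
def densityPairs (k : ℕ) : Set (ℝ × ℝ) :=
  {p | ∃ n : ℕ, 0 < n ∧ ∃ G : SimpleGraph (Fin n), p = (starDensity 1 G, starDensity k G)}

/-- The phase space of the edge/`k`-star model: the accumulation points of the pairs
(edge density, `k`-star density) of finite graphs. -/
def phaseSpace (k : ℕ) : Set (ℝ × ℝ) :=
  {p | AccPt p (Filter.principal (densityPairs k))}

/-- The values `τ` such that `(ε, τ)` lies in the phase space. -/
def phaseSlice (k : ℕ) (ε : ℝ) : Set ℝ :=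
  {τ | (ε, τ) ∈ phaseSpace k}

/-- The branch `[1 - √(1-ε)] [1 + √(1-ε) (1 - √(1-ε))^(k-1)]`. -/
noncomputable def anticliqueBranch (k : ℕ) (ε : ℝ) : ℝ :=
  (1 - √(1 - ε)) * (1 + √(1 - ε) * (1 - √(1 - ε)) ^ (k - 1))

/-- The branch `ε^((k+1)/2)`. -/
noncomputable def cliqueBranch (k : ℕ) (ε : ℝ) : ℝ :=
  ε ^ (((k : ℝ) + 1) / 2)

/-- A differentiable function whose derivative can only change sign from negative to positive is bounded by
its values at the endpoints. -/
theorem le_max_of_deriv_sign {f h ψ ψ' : ℝ → ℝ} {a b : ℝ} (hf : ContinuousOn f (Set.Icc a b))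
    (hf' : ∀ x ∈ Set.Ioo a b, HasDerivAt f (h x * ψ x) x)
    (hh : ∀ x ∈ Set.Ioo a b, 0 < h x)
    (hψ : ∀ x ∈ Set.Ioo a b, ψ x = 0 → HasDerivAt ψ (ψ' x) x ∧ 0 < ψ' x)
    {x : ℝ} (hx : x ∈ Set.Icc a b) : f x ≤ max (f a) (f b) := by
  obtain ⟨z, hz, hmax⟩ := isCompact_Icc.exists_isMaxOn ⟨x, hx⟩ hf
  refine (hmax hx).trans ?_
  rcases eq_or_lt_of_le hz.1 with rfl | haz
  · exact le_max_left _ _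
  rcases eq_or_lt_of_le hz.2 with rfl | hzb
  · exact le_max_right _ _
  exfalso
  have hzI : z ∈ Set.Ioo a b := ⟨haz, hzb⟩
  have hloc : IsLocalMax f z := hmax.isLocalMax (Icc_mem_nhds haz hzb)
  have h0 : ψ z = 0 := by
    have := hloc.hasDerivAt_eq_zero (hf' z hzI)
    rcases mul_eq_zero.1 this with h | h
    · exact absurd h (hh z hzI).ne'
    · exact h
  obtain ⟨hd, hpos⟩ := hψ z hzI h0
  have hs : ∀ᶠ y in nhdsWithin z (Set.Ioi z), 0 < slope ψ z y :=
    ((hasDerivAt_iff_tendsto_slope.1 hd).mono_left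
      (nhdsWithin_mono _ fun y hy => ne_of_gt hy)).eventually (lt_mem_nhds hpos)
  obtain ⟨u, hu, hsub⟩ := (mem_nhdsGT_iff_exists_Ioo_subset' hzb).1 hs
  set w := min u b with hw
  have hzw : z < w := lt_min hu hzb
  have hwb : w ≤ b := min_le_right _ _
  have hwu : w ≤ u := min_le_left _ _
  have hmono : StrictMonoOn f (Set.Icc z w) := by
    refine strictMonoOn_of_deriv_pos (convex_Icc _ _)
      (hf.mono (Set.Icc_subset_Icc haz.le hwb)) fun y hy => ?_
    rw [interior_Icc] at hy
    have hyI : y ∈ Set.Ioo a b := ⟨haz.trans hy.1, hy.2.trans_le hwb⟩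
    rw [(hf' y hyI).deriv]
    have h1 : 0 < slope ψ z y := hsub ⟨hy.1, hy.2.trans_le hwu⟩
    rw [slope_def_field, h0, sub_zero] at h1
    have : 0 < ψ y := by
      rcases div_pos_iff.1 h1 with h | h
      · exact h.1
      · exact absurd h.2 (not_lt.2 (sub_nonneg.2 hy.1.le))
    exact mul_pos (hh y hyI) this
  have h1 := hmono (Set.left_mem_Icc.2 hzw.le) (Set.right_mem_Icc.2 hzw.le) hzw
  exact absurd (hmax (show w ∈ Set.Icc a b from ⟨(haz.trans hzw).le, hwb⟩)) (not_le.2 h1)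

theorem one_add_pow_ge_quadratic (k : ℕ) {d : ℝ} (hd : 0 ≤ d) :
    1 + k * d + k * (k - 1) * d ^ 2 / 2 ≤ (1 + d) ^ k := by
  induction k with
  | zero => simp
  | succ k ih =>
    have h3 : 0 ≤ (k : ℝ) * (k - 1) * d ^ 3 := by
      rcases k with _ | k
      · simp
      · push_cast; simp only [add_sub_cancel_right]; positivity
    have := mul_le_mul_of_nonneg_right ih (show 0 ≤ 1 + d by linarith)
    rw [pow_succ (1 + d) k]
    push_cast
    nlinarith

theorem one_add_pow_pade (k : ℕ) {d : ℝ} (hd : 0 ≤ d) :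
    0 ≤ (1 + d) ^ k * ((k - 2) * d - 3) + 3 + 2 * (k + 1) * d + k * (k + 1) * d ^ 2 / 2 := by
  induction k with
  | zero => simp
  | succ k ih =>
    have h1 := mul_nonneg ih (show 0 ≤ 1 + d by linarith)
    have h2 := mul_nonneg hd (sub_nonneg.2 (one_add_pow_ge_quadratic (k + 1) hd))
    rw [pow_succ (1 + d) k] at *
    push_cast at *
    nlinarith

/-- Homogeneous form of `one_add_pow_pade`. -/
theorem pow_pade (m : ℕ) {x y : ℝ} (hy : 0 < y) (hxy : y ≤ x) :
    0 ≤ x ^ (m + 2) * (m * (x - y) - 3 * y) +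
      y ^ (m + 1) * (3 * y ^ 2 + 2 * (m + 3) * (x - y) * y + (m + 2) * (m + 3) * (x - y) ^ 2 / 2) := by
  have h := one_add_pow_pade (m + 2) (d := (x - y) / y) (div_nonneg (sub_nonneg.2 hxy) hy.le)
  have e : 1 + (x - y) / y = x / y := by field_simp; ring
  rw [e] at h
  have h2 := mul_nonneg h (pow_pos hy (m + 3)).le
  refine h2.trans_eq ?_
  push_cast
  rw [div_pow]
  field_simp
  ring

/-- Convexity of `x ↦ x ^ (m + 1)` in tangent line form. -/
theorem pow_ge_tangent (m : ℕ) {x y : ℝ} (hy : 0 ≤ y) (hxy : y ≤ x) :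
    y ^ (m + 1) + (m + 1) * y ^ m * (x - y) ≤ x ^ (m + 1) := by
  induction m with
  | zero => simp
  | succ m ih =>
    have h1 := mul_le_mul_of_nonneg_left ih (hy.trans hxy)
    have h2 : 0 ≤ (m + 1 : ℝ) * y ^ m * (x - y) * (x - y) := by
      have := sub_nonneg.2 hxy
      positivity
    rw [pow_succ x (m + 1), pow_succ y (m + 1)]
    push_cast
    rw [pow_succ y m] at *
    nlinarith

/-- The second derivative test along the family of cliques with a dominating set. -/
theorem clique_dominating_second_order (m : ℕ) {v c : ℝ} (hv : 0 < v) (hvc : v < c) (hc : c < 1)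
    (hψ : (1 - c) * ((m + 3) * c ^ (m + 2) - (m + 2) * c ^ (m + 1) * v - v ^ (m + 2)) -
      (c - v) * (1 - c ^ (m + 2) + (m + 2) * (1 - c) * v ^ (m + 1)) = 0) :
    0 < -2 * (1 - c) * ((m + 3) * c ^ (m + 2) - (m + 2) * c ^ (m + 1) * v - v ^ (m + 2)) -
      (1 - c) * (1 - c ^ (m + 2) + (m + 2) * (1 - c) * v ^ (m + 1)) +
      (1 - c) ^ 2 * ((m + 2) * (m + 3) * c ^ (m + 1) - (m + 2) * (m + 1) * c ^ m * v) +
      2 * (1 - c) * (c - v) * (m + 2) * (c ^ (m + 1) + v ^ (m + 1)) +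
      (c - v) ^ 2 * (m + 2) * (m + 1) * (1 - c) * v ^ m := by
  have hp : 0 < c - v := sub_pos.2 hvc
  have hy : 0 < 1 - c := sub_pos.2 hc
  have hc0 : 0 < c := hv.trans hvc
  have hm : (0 : ℝ) ≤ m := m.cast_nonneg
  have h1 := pow_pade m hc0 hc.le
  have h2 := pow_pade m hv hvc.le
  have hvm : 0 < v ^ m := pow_pos hv m
  have hcm : 0 < c ^ m := pow_pos hc0 m
  have e1 : c ^ (m + 1) = c ^ m * c := pow_succ _ _
  have e2 : c ^ (m + 2) = c ^ m * c ^ 2 := pow_add _ _ _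
  have e3 : v ^ (m + 1) = v ^ m * v := pow_succ _ _
  have e4 : v ^ (m + 2) = v ^ m * v ^ 2 := pow_add _ _ _
  have hE : c ^ m * c ^ 2 - v ^ m * v ^ 2 - (m + 2) * (v ^ m * v) * (c - v) ≥ 0 := by
    have h := pow_ge_tangent (m + 1) hv.le hvc.le
    rw [show m + 1 + 1 = m + 2 from rfl, e2, e3, e4] at h
    push_cast at h
    linarith
  rw [one_pow, e1] at h1
  rw [e2, e3] at h2
  rw [e1, e2, e3, e4] at hψ ⊢
  clear e1 e2 e3 e4
  generalize v ^ m = P at *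
  generalize c ^ m = Q at *
  -- the two consequences of the Padé bound
  have k1 : (1 - Q * c ^ 2 - (m + 2) * (Q * c) * (1 - c)) * (3 * c - m * (1 - c)) ≤
      3 / 2 * (m + 2) * (m + 1) * (1 - c) ^ 2 * (Q * c) := by linarith
  have k2 : 2 * m * (c - v) * (Q * c ^ 2 - P * v ^ 2 - (m + 2) * (P * v) * (c - v)) ≤
      3 * c * ((m + 2) * (Q * c) * (c - v) - Q * c ^ 2 + P * v ^ 2) := by
    have : 0 ≤ (m + 2 : ℝ) * (m + 1) * (c - v) ^ 2 * (P * v) := by positivity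
    nlinarith [mul_nonneg hp.le hE]
  obtain ⟨E₁, hE₁⟩ : ∃ E₁, E₁ = Q * c ^ 2 - P * v ^ 2 - (m + 2) * (P * v) * (c - v) := ⟨_, rfl⟩
  obtain ⟨E₂, hE₂⟩ : ∃ E₂, E₂ = 1 - Q * c ^ 2 - (m + 2) * (Q * c) * (1 - c) := ⟨_, rfl⟩
  obtain ⟨E₃, hE₃⟩ : ∃ E₃, E₃ = (m + 2) * (Q * c) * (c - v) - Q * c ^ 2 + P * v ^ 2 := ⟨_, rfl⟩
  rw [← hE₂] at k1
  rw [← hE₁, ← hE₃] at k2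
  have h0 : (1 - c) * E₁ = (c - v) * E₂ := by rw [hE₁, hE₂]; linear_combination hψ
  have k3 : 3 * c * E₁ ≤ (1 - c) * (m * E₁ + 3 / 2 * (m + 2) * (m + 1) * (c - v) * (Q * c)) := by
    refine le_of_mul_le_mul_left ?_ hy
    linear_combination (c - v) * k1 + (3 * c - m * (1 - c)) * h0
  have k4 : 2 * (c - v) * E₁ ≤ (1 - c) * (E₃ + (m + 2) * (m + 1) * (c - v) ^ 2 * Q) := by
    refine le_of_mul_le_mul_left ?_ (show 0 < 3 * c by positivity)
    linear_combination 2 * (c - v) * k3 + (1 - c) * k2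
  refine pos_of_mul_pos_right (a := c - v) ?_ hp.le
  have k5 : 0 < (m + 2) * (m + 1) * (c - v) ^ 3 * (1 - c) * P := by positivity
  rw [hE₁, hE₃] at k4
  linear_combination k5 + (1 - c) * k4 - (1 - c) * hψ

theorem anticliqueBranch_eq (m : ℕ) {a : ℝ} (ha : a ≤ 1) :
    anticliqueBranch (m + 2) (a * (2 - a)) = a + (1 - a) * a ^ (m + 2) := by
  have : √(1 - a * (2 - a)) = 1 - a := by
    rw [show 1 - a * (2 - a) = (1 - a) ^ 2 by ring, Real.sqrt_sq (sub_nonneg.2 ha)]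
  rw [anticliqueBranch, this, show m + 2 - 1 = m + 1 from rfl]
  ring

theorem cliqueBranch_sq (k : ℕ) {w : ℝ} (hw : 0 ≤ w) : cliqueBranch k (w ^ 2) = w ^ (k + 1) := by
  rw [cliqueBranch, ← Real.rpow_natCast w 2, ← Real.rpow_mul hw, ← Real.rpow_natCast w (k + 1)]
  congr 1
  push_cast
  ring

/-- The size of the dominating set in the complement of a clique, of edge density `e`. -/
theorem antiRoot_mul {e : ℝ} (he : e ≤ 1) : (1 - √(1 - e)) * (2 - (1 - √(1 - e))) = e := by
  have := Real.sq_sqrt (sub_nonneg.2 he)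
  linear_combination -this

theorem antiRoot_le {e c : ℝ} (he : e ≤ c * (2 - c)) : 1 - √(1 - e) ≤ c := by
  have : 1 - c ≤ √(1 - e) := Real.le_sqrt_of_sq_le (by linarith)
  linarith

theorem lt_of_antiRoot_lt {e c : ℝ} (hc : c ≤ 1) (h : 1 - √(1 - e) < c) : e < c * (2 - c) := by
  have h1 : 1 - c < √(1 - e) := by linarith
  have := (Real.lt_sqrt (sub_nonneg.2 hc)).1 h1
  linarith

theorem antiRoot_nonneg {e : ℝ} (he : 0 ≤ e) : 0 ≤ 1 - √(1 - e) :=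
  sub_nonneg.2 (Real.sqrt_le_one.2 (by linarith))

theorem antiRoot_le_one (e : ℝ) : 1 - √(1 - e) ≤ 1 := by
  linarith [Real.sqrt_nonneg (1 - e)]

theorem anticliqueBranch_eq' (m : ℕ) {e : ℝ} (he : e ≤ 1) :
    anticliqueBranch (m + 2) e =
      (1 - √(1 - e)) + (1 - (1 - √(1 - e))) * (1 - √(1 - e)) ^ (m + 2) := by
  rw [← anticliqueBranch_eq m (antiRoot_le_one e), antiRoot_mul he]

theorem cliqueBranch_eq (k : ℕ) {e : ℝ} (he : 0 ≤ e) : cliqueBranch k e = √e ^ (k + 1) := by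
  rw [← cliqueBranch_sq k (Real.sqrt_nonneg e), Real.sq_sqrt he]

/-- Complements of cliques with isolated vertices added. -/
theorem anticlique_isolated_le (m : ℕ) {c s : ℝ} (hc : 0 ≤ c) (hcs : c ≤ s) (hs : s ≤ 1) :
    c * s ^ (m + 2) + (s - c) * c ^ (m + 2) ≤
      max (anticliqueBranch (m + 2) (2 * c * s - c ^ 2)) (cliqueBranch (m + 2) (2 * c * s - c ^ 2)) := by
  rcases hc.eq_or_lt with rfl | hc0
  · simp [anticliqueBranch]
  obtain ⟨e, he⟩ : ∃ e, e = 2 * c * s - c ^ 2 := ⟨_, rfl⟩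
  rw [← he]
  have hs0 : 0 < s := hc0.trans_le hcs
  have he0 : 0 < e := by nlinarith [mul_pos hc0 hs0]
  have hec : e ≤ c * (2 - c) := by nlinarith
  have he1 : e ≤ 1 := hec.trans (by nlinarith [sq_nonneg (1 - c)])
  have ha0 : 0 < 1 - √(1 - e) := by
    have : √(1 - e) < 1 := by rw [Real.sqrt_lt' one_pos]; linarith
    linarith
  obtain ⟨a, ha⟩ : ∃ a, a = 1 - √(1 - e) := ⟨_, rfl⟩
  have hae : a * (2 - a) = e := by rw [ha]; exact antiRoot_mul he1
  have hb : √e ^ 2 = e := Real.sq_sqrt he0.le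
  have hb0 : 0 < √e := Real.sqrt_pos.2 he0
  obtain ⟨S, hS⟩ : ∃ S : ℝ → ℝ, S = fun x => (e + x ^ 2) / (2 * x) := ⟨_, rfl⟩
  have hSd : ∀ x, 0 < x → HasDerivAt S (-(S x - x) / x) x := by
    intro x hx
    have h := (((hasDerivAt_id x).pow 2).const_add e).div ((hasDerivAt_id x).const_mul 2)
      (by simp [hx.ne'])
    rw [hS]
    refine h.congr_deriv ?_
    simp only [id, Pi.pow_apply]
    field_simp
    ring
  have hSx : ∀ x ∈ Set.Ioo a √e, 0 < x ∧ x < S x := by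
    intro x hx
    have hx0 : 0 < x := (ha ▸ ha0).trans hx.1
    refine ⟨hx0, ?_⟩
    rw [hS]
    simp only
    rw [lt_div_iff₀ (by positivity)]
    have : x ^ 2 < √e ^ 2 := pow_lt_pow_left₀ hx.2 hx0.le two_ne_zero
    nlinarith
  have key := le_max_of_deriv_sign (a := a) (b := √e) (x := c)
    (f := fun x => x * S x ^ (m + 2) + (S x - x) * x ^ (m + 2))
    (h := fun x => S x ^ (m + 1) - x ^ (m + 1))
    (ψ := fun x => (m + 2) * x - (m + 1) * S x)
    (ψ' := fun x => (m + 2) - (m + 1) * (-(S x - x) / x))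
    (fun x hx => by
      have hx0 : 0 < x := (ha ▸ ha0).trans_le hx.1
      have := (hSd x hx0).continuousAt
      exact ContinuousAt.continuousWithinAt (by fun_prop))
    (fun x hx => by
      obtain ⟨hx0, hxS⟩ := hSx x hx
      have h1 := hSd x hx0
      have h := ((hasDerivAt_id x).mul (h1.pow (m + 2))).add
        ((h1.sub (hasDerivAt_id x)).mul ((hasDerivAt_id x).pow (m + 2)))
      refine h.congr_deriv ?_
      simp only [id, Pi.pow_apply, Pi.sub_apply]
      generalize S x = y
      push_cast
      simp only [pow_succ]
      field_simp
      ring)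
    (fun x hx => by
      obtain ⟨hx0, hxS⟩ := hSx x hx
      exact sub_pos.2 (pow_lt_pow_left₀ hxS hx0.le (by simp)))
    (fun x hx _ => by
      obtain ⟨hx0, hxS⟩ := hSx x hx
      refine ⟨(((hasDerivAt_id x).const_mul ((m : ℝ) + 2)).sub
        ((hSd x hx0).const_mul ((m : ℝ) + 1))).congr_deriv (by simp), ?_⟩
      have : -(S x - x) / x < 0 := div_neg_of_neg_of_pos (by linarith) hx0
      nlinarith [show (0 : ℝ) ≤ m from m.cast_nonneg])
    ⟨ha ▸ antiRoot_le hec, Real.le_sqrt_of_sq_le (by nlinarith)⟩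
  have e1 : S c = s := by rw [hS, he]; field_simp; ring
  have e2 : S a = 1 := by
    have : 0 < a := ha ▸ ha0
    rw [hS, ← hae]; field_simp; ring
  have e3 : S √e = √e := by
    rw [hS]; simp only; rw [hb, div_eq_iff (by positivity)]; linear_combination -2 * hb
  simp only [e1, e2, e3] at key
  rw [anticliqueBranch_eq' m he1, cliqueBranch_eq _ he0.le, ← ha]
  convert key using 2 <;> ring

/-- Cliques with a dominating set inside. -/
theorem clique_dominating_le (m : ℕ) {v c : ℝ} (hv : 0 ≤ v) (hvc : v ≤ c) (hc : c ≤ 1) :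
    c ^ (m + 3) + (1 - c ^ (m + 2)) * v + (1 - c) * v ^ (m + 2) ≤
      max (anticliqueBranch (m + 2) (c ^ 2 + 2 * v * (1 - c)))
        (cliqueBranch (m + 2) (c ^ 2 + 2 * v * (1 - c))) := by
  rcases hc.eq_or_lt with rfl | hc1
  · simp [cliqueBranch]
  have hc0 : 0 ≤ c := hv.trans hvc
  obtain ⟨e, he⟩ : ∃ e, e = c ^ 2 + 2 * v * (1 - c) := ⟨_, rfl⟩
  rw [← he]
  have he0 : 0 ≤ e := by rw [he]; have := sub_pos.2 hc1; positivity
  have hec : e ≤ c * (2 - c) := by nlinarith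
  have he1 : e < 1 := hec.trans_lt (by nlinarith [pow_pos (sub_pos.2 hc1) 2])
  obtain ⟨a, ha⟩ : ∃ a, a = 1 - √(1 - e) := ⟨_, rfl⟩
  have ha0 : 0 ≤ a := ha ▸ antiRoot_nonneg he0
  have hae : a * (2 - a) = e := by rw [ha]; exact antiRoot_mul he1.le
  have hb : √e ^ 2 = e := Real.sq_sqrt he0
  have hb1 : √e < 1 := by rw [Real.sqrt_lt' one_pos]; linarith
  obtain ⟨V, hV⟩ : ∃ V : ℝ → ℝ, V = fun x => (e - x ^ 2) / (2 * (1 - x)) := ⟨_, rfl⟩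
  have hVd : ∀ x, x < 1 → HasDerivAt V (-(x - V x) / (1 - x)) x := by
    intro x hx
    have hx' := (sub_pos.2 hx).ne'
    have h := (((hasDerivAt_id x).pow 2).const_sub e).div
      (((hasDerivAt_id x).const_sub 1).const_mul 2) (by simp [hx'])
    rw [hV]
    refine h.congr_deriv ?_
    simp only [id, Pi.pow_apply]
    field_simp
    ring
  have hVx : ∀ x ∈ Set.Ioo a √e, x < 1 ∧ 0 < V x ∧ V x < x := by
    intro x hx
    have hx1 : x < 1 := hx.2.trans hb1
    have hx0 : 0 ≤ x := ha0.trans hx.1.le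
    have h1 : x ^ 2 < √e ^ 2 := pow_lt_pow_left₀ hx.2 hx0 two_ne_zero
    have h2 := lt_of_antiRoot_lt hx1.le (ha ▸ hx.1)
    have h3 := sub_pos.2 hx1
    rw [hV]
    refine ⟨hx1, div_pos (by linarith) (by linarith), ?_⟩
    simp only
    rw [div_lt_iff₀ (by linarith)]
    linarith
  have hψd : ∀ x, x < 1 → HasDerivAt (fun x => (1 - x) * ((m + 3) * x ^ (m + 2) -
      (m + 2) * x ^ (m + 1) * V x - V x ^ (m + 2)) -
      (x - V x) * (1 - x ^ (m + 2) + (m + 2) * (1 - x) * V x ^ (m + 1)))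
      ((-2 * (1 - x) * ((m + 3) * x ^ (m + 2) - (m + 2) * x ^ (m + 1) * V x - V x ^ (m + 2)) -
      (1 - x) * (1 - x ^ (m + 2) + (m + 2) * (1 - x) * V x ^ (m + 1)) +
      (1 - x) ^ 2 * ((m + 2) * (m + 3) * x ^ (m + 1) - (m + 2) * (m + 1) * x ^ m * V x) +
      2 * (1 - x) * (x - V x) * (m + 2) * (x ^ (m + 1) + V x ^ (m + 1)) +
      (x - V x) ^ 2 * (m + 2) * (m + 1) * (1 - x) * V x ^ m +
      ((1 - x) * ((m + 3) * x ^ (m + 2) - (m + 2) * x ^ (m + 1) * V x - V x ^ (m + 2)) -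
      (x - V x) * (1 - x ^ (m + 2) + (m + 2) * (1 - x) * V x ^ (m + 1)))) / (1 - x)) x := by
    intro x hx
    have hx' := (sub_pos.2 hx).ne'
    have h1 := hVd x hx
    have hid := hasDerivAt_id x
    have h := ((hid.const_sub 1).mul ((((hid.pow (m + 2)).const_mul ((m : ℝ) + 3)).sub
      (((hid.pow (m + 1)).const_mul ((m : ℝ) + 2)).mul h1)).sub (h1.pow (m + 2)))).sub
      ((hid.sub h1).mul (((hid.pow (m + 2)).const_sub 1).add
        (((hid.const_sub 1).const_mul ((m : ℝ) + 2)).mul (h1.pow (m + 1)))))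
    refine h.congr_deriv ?_
    simp only [id, Pi.pow_apply, Pi.sub_apply, Pi.mul_apply, Pi.add_apply]
    generalize V x = y
    push_cast
    simp only [pow_succ]
    field_simp
    ring
  have key := le_max_of_deriv_sign (a := a) (b := √e) (x := c)
    (f := fun x => x ^ (m + 3) + (1 - x ^ (m + 2)) * V x + (1 - x) * V x ^ (m + 2))
    (h := fun x => 1 / (1 - x))
    (ψ := fun x => (1 - x) * ((m + 3) * x ^ (m + 2) - (m + 2) * x ^ (m + 1) * V x - V x ^ (m + 2)) -
      (x - V x) * (1 - x ^ (m + 2) + (m + 2) * (1 - x) * V x ^ (m + 1)))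
    (ψ' := _)
    (fun x hx => by
      have := (hVd x (hx.2.trans_lt hb1)).continuousAt
      exact ContinuousAt.continuousWithinAt (by fun_prop))
    (fun x hx => by
      obtain ⟨hx1, hx0, hxV⟩ := hVx x hx
      have hx' := (sub_pos.2 hx1).ne'
      have h1 := hVd x hx1
      have hid := hasDerivAt_id x
      have h := ((hid.pow (m + 3)).add (((hid.pow (m + 2)).const_sub 1).mul h1)).add
        ((hid.const_sub 1).mul (h1.pow (m + 2)))
      refine h.congr_deriv ?_
      simp only [id, Pi.pow_apply]
      generalize V x = y
      push_cast
      simp only [pow_succ]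
      field_simp
      ring)
    (fun x hx => one_div_pos.2 (sub_pos.2 (hVx x hx).1))
    (fun x hx h0 => by
      obtain ⟨hx1, hx0, hxV⟩ := hVx x hx
      refine ⟨hψd x hx1, ?_⟩
      rw [h0, add_zero]
      exact div_pos (clique_dominating_second_order m hx0 hxV hx1 h0) (sub_pos.2 hx1))
    ⟨ha ▸ antiRoot_le hec, Real.le_sqrt_of_sq_le (by nlinarith [mul_nonneg hv (sub_pos.2 hc1).le])⟩
  have hc' := (sub_pos.2 hc1).ne'
  have e1 : V c = v := by rw [hV, he]; field_simp; ring
  have e2 : V a = a := by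
    have : 1 - a ≠ 0 := by
      rw [ha]
      have := Real.sqrt_pos.2 (sub_pos.2 he1)
      linarith
    rw [hV, ← hae]; field_simp; ring
  have e3 : V √e = 0 := by rw [hV]; simp [hb]
  simp only [e1, e2, e3] at key
  rw [anticliqueBranch_eq' m he1.le, cliqueBranch_eq _ he0, ← ha]
  convert key using 2 <;> ring

theorem split_three_le (m : ℕ) {v c s : ℝ} (hv : 0 ≤ v) (hvc : v ≤ c) (hcs : c ≤ s) (hs : s ≤ 1) :
    c * s ^ (m + 2) + (s - c) * c ^ (m + 2) + v * (1 - s ^ (m + 2)) + (1 - s) * v ^ (m + 2) ≤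
      max (anticliqueBranch (m + 2) (2 * c * s - c ^ 2 + 2 * v * (1 - s)))
        (cliqueBranch (m + 2) (2 * c * s - c ^ 2 + 2 * v * (1 - s))) := by
  have hc0 : 0 ≤ c := hv.trans hvc
  rcases hs.eq_or_lt with rfl | hs1
  · simpa using anticlique_isolated_le m hc0 hcs le_rfl
  obtain ⟨e, he⟩ : ∃ e, e = 2 * c * s - c ^ 2 + 2 * v * (1 - s) := ⟨_, rfl⟩
  rw [← he]
  have hy := sub_pos.2 hs1
  have he0 : 0 ≤ e := by nlinarith [mul_nonneg hc0 (hc0.trans hcs), mul_nonneg hv hy.le]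
  have hec : e ≤ c * (2 - c) := by nlinarith
  have hes : e ≤ s * (2 - s) := by nlinarith
  have he1 : e < 1 := hes.trans_lt (by nlinarith [pow_pos (sub_pos.2 hs1) 2])
  obtain ⟨a, ha⟩ : ∃ a, a = 1 - √(1 - e) := ⟨_, rfl⟩
  have ha0 : 0 ≤ a := ha ▸ antiRoot_nonneg he0
  have hae : a * (2 - a) = e := by rw [ha]; exact antiRoot_mul he1.le
  obtain ⟨b, hb⟩ : ∃ b, b = s - √(s ^ 2 - e) := ⟨_, rfl⟩
  have hbs : b ≤ s := by linarith [Real.sqrt_nonneg (s ^ 2 - e)]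
  have hac : a ≤ c := ha ▸ antiRoot_le hec
  have hcb : c ≤ b := by
    have : √(s ^ 2 - e) ≤ s - c :=
      Real.sqrt_le_iff.2 ⟨sub_nonneg.2 hcs, by nlinarith [mul_nonneg hv hy.le]⟩
    linarith
  have hb0 : 0 ≤ b := hc0.trans hcb
  obtain ⟨V, hV⟩ : ∃ V : ℝ → ℝ, V = fun x => (e - 2 * s * x + x ^ 2) / (2 * (1 - s)) := ⟨_, rfl⟩
  have hVd : ∀ x, HasDerivAt V (-(s - x) / (1 - s)) x := by
    intro x
    have h := ((((hasDerivAt_id x).const_mul (2 * s)).const_sub e).add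
      ((hasDerivAt_id x).pow 2)).div_const (2 * (1 - s))
    rw [hV]
    refine h.congr_deriv ?_
    simp only [id]
    field_simp
    ring
  have hVx : ∀ x ∈ Set.Ioo a b, 0 < x ∧ x < s ∧ 0 < V x := by
    intro x hx
    have hx1 : x < s := hx.2.trans_le hbs
    have h1 : √(s ^ 2 - e) < s - x := by linarith [hx.2]
    have h2 := (Real.sqrt_lt' (sub_pos.2 hx1)).1 h1
    refine ⟨ha0.trans_lt hx.1, hx1, ?_⟩
    rw [hV]
    exact div_pos (by linarith) (by linarith)
  have key := le_max_of_deriv_sign (a := a) (b := b) (x := c)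
    (f := fun x => x * s ^ (m + 2) + (s - x) * x ^ (m + 2) + V x * (1 - s ^ (m + 2)) +
      (1 - s) * V x ^ (m + 2))
    (h := fun x => s - x)
    (ψ := fun x => (s ^ (m + 2) - x ^ (m + 2)) / (s - x) + (m + 2) * x ^ (m + 1) -
      (1 - s ^ (m + 2)) / (1 - s) - (m + 2) * V x ^ (m + 1))
    (ψ' := fun x => (s ^ (m + 2) - x ^ (m + 2) - (m + 2) * x ^ (m + 1) * (s - x)) / (s - x) ^ 2 +
      (m + 2) * (m + 1) * x ^ m + (m + 2) * (m + 1) * V x ^ m * ((s - x) / (1 - s)))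
    (fun x _ => by
      have := (hVd x).continuousAt
      exact ContinuousAt.continuousWithinAt (by fun_prop))
    (fun x hx => by
      obtain ⟨hx0, hxs, hxV⟩ := hVx x hx
      have hx' := (sub_pos.2 hxs).ne'
      have h1 := hVd x
      have hid := hasDerivAt_id x
      have h := (((hid.mul_const (s ^ (m + 2))).add ((hid.const_sub s).mul (hid.pow (m + 2)))).add
        (h1.mul_const (1 - s ^ (m + 2)))).add ((h1.pow (m + 2)).const_mul (1 - s))
      refine h.congr_deriv ?_
      simp only [id, Pi.pow_apply]
      generalize V x = y
      push_cast
      simp only [pow_succ]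
      field_simp
      ring)
    (fun x hx => sub_pos.2 (hVx x hx).2.1)
    (fun x hx _ => by
      obtain ⟨hx0, hxs, hxV⟩ := hVx x hx
      have hx' := sub_pos.2 hxs
      constructor
      · have hx'' := hx'.ne'
        have h1 := hVd x
        have hid := hasDerivAt_id x
        have h := ((((hid.pow (m + 2)).const_sub (s ^ (m + 2))).div (hid.const_sub s) hx'').add
          ((hid.pow (m + 1)).const_mul ((m : ℝ) + 2))).sub_const ((1 - s ^ (m + 2)) / (1 - s))
          |>.sub ((h1.pow (m + 1)).const_mul ((m : ℝ) + 2))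
        refine h.congr_deriv ?_
        simp only [id, Pi.pow_apply]
        generalize V x = y
        push_cast
        simp only [pow_succ]
        field_simp
        ring
      · have h1 := pow_ge_tangent (m + 1) hx0.le hxs.le
        push_cast at h1
        have h2 : 0 ≤ s ^ (m + 2) - x ^ (m + 2) - (m + 2) * x ^ (m + 1) * (s - x) := by
          linarith
        positivity)
    ⟨hac, hcb⟩
  have e1 : V c = v := by rw [hV, he]; field_simp; ring
  have e2 : V a = a := by rw [hV, ← hae]; field_simp; ring
  simp only [e1] at key
  refine key.trans (max_le ?_ ?_)
  · rw [e2]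
    refine le_max_of_le_left ?_
    rw [anticliqueBranch_eq' m he1.le, ← ha]
    apply le_of_eq
    ring
  · rcases le_or_gt e (s ^ 2) with h | h
    · have hb2 : 2 * b * s - b ^ 2 = e := by
        have := Real.sq_sqrt (sub_nonneg.2 h)
        rw [hb]
        linear_combination -this
      have e3 : V b = 0 := by rw [hV, ← hb2]; simp only; rw [div_eq_zero_iff]; left; ring
      have := anticlique_isolated_le m hb0 hbs hs
      rw [hb2] at this
      simpa [e3] using this
    · have hb2 : b = s := by rw [hb, Real.sqrt_eq_zero_of_nonpos (by linarith), sub_zero]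
      have hVs : s ^ 2 + 2 * V s * (1 - s) = e := by rw [hV]; field_simp; ring
      have h0 : 0 ≤ V s := by
        by_contra! h0
        nlinarith
      have h1 : V s ≤ s := by
        by_contra! h1
        nlinarith
      have := clique_dominating_le m h0 h1 hs
      rw [hVs] at this
      rw [hb2]
      refine le_of_eq_of_le ?_ this
      ring

theorem split_four_le (m : ℕ) {v c s r : ℝ} (hv : 0 ≤ v) (hvc : v ≤ c) (hcs : c ≤ s) (hsr : s ≤ r)
    (hr : r ≤ 1) :
    c * s ^ (m + 2) + (s - c) * c ^ (m + 2) + v * (r ^ (m + 2) - s ^ (m + 2)) +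
        (r - s) * v ^ (m + 2) ≤
      max (anticliqueBranch (m + 2) (2 * c * s - c ^ 2 + 2 * v * (r - s)))
        (cliqueBranch (m + 2) (2 * c * s - c ^ 2 + 2 * v * (r - s))) := by
  have hc0 := hv.trans hvc
  have hs0 := hc0.trans hcs
  rcases (hs0.trans hsr).eq_or_lt with h0 | hr0
  · have h1 : s = 0 := by linarith
    have h2 : c = 0 := by linarith
    have h3 : v = 0 := by linarith
    simp [h1, h2, h3, anticliqueBranch]
  have hv' : 0 ≤ v / r := by positivity
  have hvc' : v / r ≤ c / r := by gcongr
  have hcs' : c / r ≤ s / r := by gcongr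
  have hs' : s / r ≤ 1 := (div_le_one hr0).2 hsr
  have hc' : 0 ≤ c / r := hv'.trans hvc'
  have key := split_three_le m hv' hvc' hcs' hs'
  obtain ⟨e, he⟩ : ∃ e, e = 2 * (c / r) * (s / r) - (c / r) ^ 2 + 2 * (v / r) * (1 - s / r) := ⟨_, rfl⟩
  rw [← he] at key
  have heq : 2 * c * s - c ^ 2 + 2 * v * (r - s) = r ^ 2 * e := by rw [he]; field_simp
  have he0 : 0 ≤ e := by
    rw [he]
    nlinarith [mul_nonneg hv' (sub_nonneg.2 hs'), mul_nonneg hc' (hc'.trans hcs'),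
      mul_nonneg hc' (sub_nonneg.2 hcs')]
  have he1 : e ≤ 1 := by
    rw [he]
    nlinarith [mul_le_mul_of_nonneg_right hvc' (sub_nonneg.2 hs'), sq_nonneg (1 - c / r)]
  rw [heq]
  have hT : c * s ^ (m + 2) + (s - c) * c ^ (m + 2) + v * (r ^ (m + 2) - s ^ (m + 2)) +
        (r - s) * v ^ (m + 2) = r ^ (m + 3) * ((c / r) * (s / r) ^ (m + 2) +
        (s / r - c / r) * (c / r) ^ (m + 2) +
        (v / r) * (1 - (s / r) ^ (m + 2)) + (1 - s / r) * (v / r) ^ (m + 2)) := by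
    simp only [div_pow]
    field_simp
    ring
  rw [hT]
  refine (mul_le_mul_of_nonneg_left key (by positivity)).trans ?_
  rw [mul_max_of_nonneg _ _ (by positivity)]
  refine max_le ?_ (le_max_of_le_right (le_of_eq ?_))
  · obtain ⟨a, ha⟩ : ∃ a, a = 1 - √(1 - e) := ⟨_, rfl⟩
    have ha0 : 0 ≤ a := ha ▸ antiRoot_nonneg he0
    have ha1 : a ≤ 1 := ha ▸ antiRoot_le_one e
    have hae : a * (2 - a) = e := by rw [ha]; exact antiRoot_mul he1
    have h := anticlique_isolated_le m (c := r * a) (s := r) (by positivity) (by nlinarith) hr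
    rw [anticliqueBranch_eq' m he1, ← ha]
    rw [show 2 * (r * a) * r - (r * a) ^ 2 = r ^ 2 * e by rw [← hae]; ring] at h
    refine le_of_eq_of_le ?_ h
    rw [mul_pow]
    ring
  · rw [cliqueBranch_eq _ he0, cliqueBranch_eq _ (by positivity), Real.sqrt_mul (by positivity),
      Real.sqrt_sq hr0.le, mul_pow]

/-- Twice the logarithm of the quotient of the two branches at `ε = a (2 - a)`. -/
noncomputable def logRatio (m : ℕ) (a : ℝ) : ℝ :=
  2 * Real.log (1 + (1 - a) * a ^ (m + 1)) - (m + 1) * Real.log a - (m + 3) * Real.log (2 - a)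

theorem one_add_mul_pow_pos (m : ℕ) {a : ℝ} (h0 : 0 < a) (h1 : a ≤ 1) :
    0 < 1 + (1 - a) * a ^ (m + 1) := by
  have := sub_nonneg.2 h1
  positivity

theorem logRatio_hasDerivAt (m : ℕ) {a : ℝ} (h0 : 0 < a) (h1 : a ≤ 1) :
    HasDerivAt (logRatio m) (2 * ((m + 2) * a - (m + 1)) * (1 - a ^ (m + 1)) /
      (a * (2 - a) * (1 + (1 - a) * a ^ (m + 1)))) a := by
  have hN := (one_add_mul_pow_pos m h0 h1).ne'
  have h2 : 2 - a ≠ 0 := by linarith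
  have hid := hasDerivAt_id a
  have h := ((((((hid.const_sub 1).mul (hid.pow (m + 1))).const_add 1).log hN).const_mul 2).sub
    ((hid.log h0.ne').const_mul ((m : ℝ) + 1))).sub
    (((hid.const_sub 2).log h2).const_mul ((m : ℝ) + 3))
  refine h.congr_deriv ?_
  simp only [id, Pi.pow_apply, Pi.mul_apply]
  have h0' := h0.ne'
  push_cast
  obtain ⟨N, hN'⟩ : ∃ N, N = 1 + (1 - a) * a ^ (m + 1) := ⟨_, rfl⟩
  rw [← hN'] at hN ⊢
  field_simp
  rw [hN']
  ring

theorem logRatio_continuousOn (m : ℕ) {a b : ℝ} (ha : 0 < a) (hb : b ≤ 1) :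
    ContinuousOn (logRatio m) (Set.Icc a b) := fun _ hx =>
  (logRatio_hasDerivAt m (ha.trans_le hx.1) (hx.2.trans hb)).continuousAt.continuousWithinAt

theorem logRatio_one (m : ℕ) : logRatio m 1 = 0 := by
  norm_num [logRatio]

theorem logRatio_strictMonoOn (m : ℕ) :
    StrictMonoOn (logRatio m) (Set.Icc ((m + 1) / (m + 2) : ℝ) 1) := by
  refine strictMonoOn_of_deriv_pos (convex_Icc _ _)
    (logRatio_continuousOn m (by positivity) le_rfl) fun a ha => ?_
  rw [interior_Icc] at ha
  have h0 : 0 < a := lt_trans (by positivity) ha.1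
  rw [(logRatio_hasDerivAt m h0 ha.2.le).deriv]
  have h1 : (m + 1 : ℝ) < a * (m + 2) := (div_lt_iff₀ (by positivity)).1 ha.1
  have h2 : a ^ (m + 1) < 1 := pow_lt_one₀ h0.le ha.2 (by simp)
  have h3 := one_add_mul_pow_pos m h0 ha.2.le
  have h4 : 0 < 2 - a := by linarith [ha.2]
  exact div_pos (mul_pos (by linarith) (by linarith)) (by positivity)

theorem logRatio_strictAntiOn (m : ℕ) :
    StrictAntiOn (logRatio m) (Set.Ioc 0 ((m + 1) / (m + 2) : ℝ)) := by
  have hlt : ((m + 1) / (m + 2) : ℝ) < 1 := (div_lt_one (by positivity)).2 (by linarith)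
  refine strictAntiOn_of_deriv_neg (convex_Ioc _ _) (fun x hx =>
    (logRatio_hasDerivAt m hx.1 (hx.2.trans hlt.le)).continuousAt.continuousWithinAt) fun a ha => ?_
  rw [interior_Ioc] at ha
  have ha1 : a < 1 := ha.2.trans hlt
  have h0 : 0 < a := ha.1
  rw [(logRatio_hasDerivAt m h0 ha1.le).deriv]
  have h1 : a * (m + 2) < (m + 1 : ℝ) := (lt_div_iff₀ (by positivity)).1 ha.2
  have h2 : a ^ (m + 1) < 1 := pow_lt_one₀ h0.le ha1 (by simp)
  have h3 := one_add_mul_pow_pos m h0 ha1.le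
  have h4 : 0 < 2 - a := by linarith
  exact div_neg_of_neg_of_pos (mul_neg_of_neg_of_pos (by linarith) (by linarith)) (by positivity)

theorem logRatio_one_sixteenth_pos (m : ℕ) : 0 < logRatio m (1 / 16) := by
  have h1 : 0 < Real.log (1 + (1 - 1 / 16) * (1 / 16) ^ (m + 1)) := by
    apply Real.log_pos
    have : (0 : ℝ) < (1 / 16) ^ (m + 1) := by positivity
    linarith
  have h2 : Real.log (1 / 16) = -(4 * Real.log 2) := by
    rw [one_div, Real.log_inv, show (16 : ℝ) = 2 ^ 4 by norm_num, Real.log_pow]; norm_num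
  have h3 : Real.log (2 - 1 / 16) ≤ Real.log 2 := Real.log_le_log (by norm_num) (by norm_num)
  have h4 : 0 < Real.log 2 := Real.log_pos (by norm_num)
  have h5 : (m + 3 : ℝ) * Real.log (2 - 1 / 16) ≤ (m + 3) * Real.log 2 := by gcongr
  rw [logRatio, h2]
  nlinarith [mul_nonneg (show (0 : ℝ) ≤ m from m.cast_nonneg) h4.le]

/-- The unique sign change of `logRatio`. -/
theorem exists_crossing (m : ℕ) : ∃ a₀ ∈ Set.Ioo (0 : ℝ) 1, logRatio m a₀ = 0 ∧
    (∀ a ∈ Set.Ioo (0 : ℝ) 1, a < a₀ → 0 < logRatio m a) ∧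
    (∀ a ∈ Set.Ioo (0 : ℝ) 1, a₀ < a → logRatio m a < 0) := by
  obtain ⟨t, ht⟩ : ∃ t : ℝ, t = (m + 1) / (m + 2) := ⟨_, rfl⟩
  have ht1 : t < 1 := by rw [ht]; exact (div_lt_one (by positivity)).2 (by linarith)
  have ht0 : 1 / 16 < t := by
    rw [ht, div_lt_div_iff₀ (by norm_num) (by positivity)]
    linarith [show (0 : ℝ) ≤ m from m.cast_nonneg]
  have hanti := logRatio_strictAntiOn m
  have hmono := logRatio_strictMonoOn m
  rw [← ht] at hanti hmono
  have hneg : ∀ a, t ≤ a → a < 1 → logRatio m a < 0 := fun a h1 h2 => by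
    rw [← logRatio_one m]
    exact hmono ⟨h1, h2.le⟩ ⟨ht1.le, le_rfl⟩ h2
  obtain ⟨a₀, ha, h0⟩ := intermediate_value_Icc' ht0.le
    (logRatio_continuousOn m (by norm_num) ht1.le)
    ⟨(hneg t le_rfl ht1).le, (logRatio_one_sixteenth_pos m).le⟩
  have ha0 : 0 < a₀ := lt_of_lt_of_le (by norm_num) ha.1
  refine ⟨a₀, ⟨ha0, ha.2.trans_lt ht1⟩, h0, fun a h1 h2 => ?_, fun a h1 h2 => ?_⟩
  · rw [← h0]
    exact hanti ⟨h1.1, h2.le.trans ha.2⟩ ⟨ha0, ha.2⟩ h2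
  · rcases le_total t a with h | h
    · exact hneg a h h1.2
    · rw [← h0]
      exact hanti ⟨ha0, ha.2⟩ ⟨h1.1, h⟩ h2

theorem log_anticliqueBranch_sub (m : ℕ) {e : ℝ} (he : e ∈ Set.Ioo (0 : ℝ) 1) :
    0 < anticliqueBranch (m + 2) e ∧ 0 < cliqueBranch (m + 2) e ∧
    Real.log (anticliqueBranch (m + 2) e) - Real.log (cliqueBranch (m + 2) e) =
      logRatio m (1 - √(1 - e)) / 2 := by
  obtain ⟨a, ha⟩ : ∃ a, a = 1 - √(1 - e) := ⟨_, rfl⟩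
  have hae : a * (2 - a) = e := by rw [ha]; exact antiRoot_mul he.2.le
  have ha1 : a ≤ 1 := ha ▸ antiRoot_le_one e
  have ha0 : 0 < a := by
    have : √(1 - e) < 1 := by rw [Real.sqrt_lt' one_pos]; linarith [he.1]
    linarith
  have hN := one_add_mul_pow_pos m ha0 ha1
  have h2 : 0 < 2 - a := by linarith
  have hA : anticliqueBranch (m + 2) e = a * (1 + (1 - a) * a ^ (m + 1)) := by
    rw [← hae, anticliqueBranch_eq m ha1]; ring
  have hC : 0 < cliqueBranch (m + 2) e := Real.rpow_pos_of_pos he.1 _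
  refine ⟨hA ▸ mul_pos ha0 hN, hC, ?_⟩
  rw [← ha, hA, Real.log_mul ha0.ne' hN.ne', cliqueBranch, Real.log_rpow he.1, ← hae,
    Real.log_mul ha0.ne' h2.ne', logRatio]
  push_cast
  ring

/-- The two branches cross exactly once in the open unit interval. -/
theorem exists_branch_crossing (m : ℕ) : ∃ ε₀ ∈ Set.Ioo (0 : ℝ) 1,
    (∀ ε ∈ Set.Ioo (0 : ℝ) 1, anticliqueBranch (m + 2) ε = cliqueBranch (m + 2) ε ↔ ε = ε₀) ∧
    (∀ ε ∈ Set.Icc (0 : ℝ) 1, ε ≤ ε₀ → cliqueBranch (m + 2) ε ≤ anticliqueBranch (m + 2) ε) ∧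
    (∀ ε ∈ Set.Icc (0 : ℝ) 1, ε₀ ≤ ε → anticliqueBranch (m + 2) ε ≤ cliqueBranch (m + 2) ε) := by
  obtain ⟨a₀, ⟨h0, h1⟩, hz, hpos, hneg⟩ := exists_crossing m
  have hr : √(1 - a₀ * (2 - a₀)) = 1 - a₀ := by
    rw [show 1 - a₀ * (2 - a₀) = (1 - a₀) ^ 2 by ring, Real.sqrt_sq (by linarith)]
  have hI : ∀ e ∈ Set.Ioo (0 : ℝ) 1, 1 - √(1 - e) ∈ Set.Ioo (0 : ℝ) 1 := fun e he => by
    have h3 : √(1 - e) < 1 := by rw [Real.sqrt_lt' one_pos]; linarith [he.1]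
    have h4 : 0 < √(1 - e) := Real.sqrt_pos.2 (by linarith [he.2])
    exact ⟨by linarith, by linarith⟩
  have hlt : ∀ e ∈ Set.Ioo (0 : ℝ) 1, e < a₀ * (2 - a₀) →
      cliqueBranch (m + 2) e < anticliqueBranch (m + 2) e := fun e he h => by
    obtain ⟨hA, hC, hlog⟩ := log_anticliqueBranch_sub m he
    have h3 : √(1 - a₀ * (2 - a₀)) < √(1 - e) :=
      Real.sqrt_lt_sqrt (by nlinarith) (by linarith)
    have := hpos _ (hI e he) (by linarith)
    exact (Real.log_lt_log_iff hC hA).1 (by linarith)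
  have hgt : ∀ e ∈ Set.Ioo (0 : ℝ) 1, a₀ * (2 - a₀) < e →
      anticliqueBranch (m + 2) e < cliqueBranch (m + 2) e := fun e he h => by
    obtain ⟨hA, hC, hlog⟩ := log_anticliqueBranch_sub m he
    have h3 : √(1 - e) < √(1 - a₀ * (2 - a₀)) :=
      Real.sqrt_lt_sqrt (by linarith [he.2]) (by linarith)
    have := hneg _ (hI e he) (by linarith)
    exact (Real.log_lt_log_iff hA hC).1 (by linarith)
  have heI : a₀ * (2 - a₀) ∈ Set.Ioo (0 : ℝ) 1 := ⟨by nlinarith, by nlinarith⟩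
  have heq : anticliqueBranch (m + 2) (a₀ * (2 - a₀)) = cliqueBranch (m + 2) (a₀ * (2 - a₀)) := by
    obtain ⟨hA, hC, hlog⟩ := log_anticliqueBranch_sub m heI
    rw [hr, sub_sub_cancel, hz] at hlog
    exact Real.log_injOn_pos hA hC (by linarith)
  refine ⟨a₀ * (2 - a₀), heI, fun e he => ⟨fun h => ?_, fun h => h ▸ heq⟩, fun e he h => ?_,
    fun e he h => ?_⟩
  · rcases lt_trichotomy e (a₀ * (2 - a₀)) with h' | h' | h'
    · exact absurd h (hlt e he h').ne'
    · exact h'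
    · exact absurd h (hgt e he h').ne
  · rcases he.1.eq_or_lt with rfl | he0
    · simp only [anticliqueBranch, cliqueBranch]
      rw [Real.zero_rpow (by positivity)]
      simp
    rcases h.eq_or_lt with rfl | h
    · exact heq.ge
    · exact (hlt e ⟨he0, h.trans heI.2⟩ h).le
  · rcases he.2.eq_or_lt with rfl | he1
    · simp [anticliqueBranch, cliqueBranch]
    rcases h.eq_or_lt with rfl | h
    · exact heq.le
    · exact (hgt e ⟨heI.1.trans h, he1⟩ h).le

theorem branch_two_half : anticliqueBranch 2 (1 / 2) = cliqueBranch 2 (1 / 2) := by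
  have h1 : √(1 / 2 : ℝ) ^ 2 = 1 / 2 := Real.sq_sqrt (by norm_num)
  rw [cliqueBranch_eq 2 (by norm_num), anticliqueBranch, show (1 : ℝ) - 1 / 2 = 1 / 2 by norm_num]
  generalize √(1 / 2 : ℝ) = x at *
  norm_num
  linear_combination (-2 : ℝ) * h1

theorem branch_three_three_quarters : anticliqueBranch 3 (3 / 4) = cliqueBranch 3 (3 / 4) := by
  have h2 : √(1 - 3 / 4 : ℝ) = 1 / 2 := by
    rw [show (1 - 3 / 4 : ℝ) = (1 / 2) ^ 2 by norm_num, Real.sqrt_sq (by norm_num)]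
  have h1 : √(3 / 4 : ℝ) ^ 2 = 3 / 4 := Real.sq_sqrt (by norm_num)
  rw [cliqueBranch_eq 3 (by norm_num), anticliqueBranch, h2,
    show √(3 / 4 : ℝ) ^ (3 + 1) = (√(3 / 4 : ℝ) ^ 2) ^ 2 by ring, h1]
  norm_num

/-- The degree of a vertex, as a real number. -/
noncomputable def degR {n : ℕ} (G : SimpleGraph (Fin n)) (v : Fin n) : ℝ :=
  Nat.card (G.neighborSet v)

open Classical in
theorem degR_eq_sum {n : ℕ} (G : SimpleGraph (Fin n)) (v : Fin n) :
    degR G v = ∑ w, if G.Adj v w then (1 : ℝ) else 0 := by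
  rw [degR, Finset.sum_boole, Nat.card_eq_fintype_card, Fintype.card_subtype]
  rfl

theorem degR_nonneg {n : ℕ} (G : SimpleGraph (Fin n)) (v : Fin n) : 0 ≤ degR G v :=
  Nat.cast_nonneg _

theorem degR_le {n : ℕ} (G : SimpleGraph (Fin n)) (v : Fin n) : degR G v ≤ n := by
  classical
  rw [degR_eq_sum]
  refine (Finset.sum_le_sum fun w _ => (show _ ≤ (1 : ℝ) by split_ifs <;> norm_num)).trans ?_
  simp

/-- Homomorphisms from a star are a choice of the image of the centre and of `k` of its neighbours. -/
def starHomEquiv (k : ℕ) {V : Type*} (G : SimpleGraph V) :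
    (SimpleGraph.starGraph (0 : Fin (k + 1)) →g G) ≃ Σ v : V, (Fin k → G.neighborSet v) where
  toFun f := ⟨f 0, fun i => ⟨f i.succ,
    f.map_adj (SimpleGraph.starGraph_center_adj (Fin.succ_ne_zero i).symm)⟩⟩
  invFun p := ⟨Fin.cons p.1 fun i => (p.2 i).1, by
    intro a b hab
    obtain ⟨hne, rfl | rfl⟩ := SimpleGraph.starGraph_adj.1 hab
    · obtain ⟨i, rfl⟩ := Fin.exists_succ_eq.2 hne.symm
      exact (p.2 i).2
    · obtain ⟨i, rfl⟩ := Fin.exists_succ_eq.2 hne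
      exact (p.2 i).2.symm⟩
  left_inv f := by
    ext a
    refine Fin.cases ?_ (fun i => ?_) a <;> rfl
  right_inv p := rfl

theorem starDensity_eq (k : ℕ) {n : ℕ} (G : SimpleGraph (Fin n)) :
    starDensity k G = (∑ v, degR G v ^ k) / (n : ℝ) ^ (k + 1) := by
  rw [starDensity, Nat.card_congr (starHomEquiv k G), Nat.card_sigma]
  congr 1
  push_cast
  refine Finset.sum_congr rfl fun v _ => ?_
  rw [Nat.card_fun, Nat.card_fin, Nat.cast_pow, degR]

open Classical in
/-- Moving the edge `lj` to `li`. -/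
theorem exists_shift {n : ℕ} (G : SimpleGraph (Fin n)) {i j l : Fin n} (hij : i ≠ j) (hli : l ≠ i)
    (hlj : l ≠ j) (h1 : G.Adj l j) (h2 : ¬ G.Adj l i) : ∃ G' : SimpleGraph (Fin n),
    ∀ v, degR G' v = degR G v + (if v = i then 1 else 0) - (if v = j then 1 else 0) := by
  obtain ⟨G', hG'⟩ : ∃ G' : SimpleGraph (Fin n), ∀ x y, G'.Adj x y ↔
      (G.Adj x y ∧ s(x, y) ≠ s(l, j)) ∨ s(x, y) = s(l, i) := by
    refine ⟨⟨fun x y => (G.Adj x y ∧ s(x, y) ≠ s(l, j)) ∨ s(x, y) = s(l, i), ⟨?_⟩, ⟨?_⟩⟩,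
      fun _ _ => Iff.rfl⟩
    · intro x y h
      rwa [G.adj_comm y x, Sym2.eq_swap (a := y)]
    · rintro x (h | h)
      · exact h.1.ne rfl
      · rcases Sym2.eq_iff.1 h with h | h
        · exact hli (h.1.symm.trans h.2)
        · exact hli (h.2.symm.trans h.1)
  refine ⟨G', fun v => ?_⟩
  have key : ∀ w, (if G'.Adj v w then (1 : ℝ) else 0) =
      (if G.Adj v w then 1 else 0) + (if w = l then if v = i then 1 else 0 else 0) +
      (if w = i then if v = l then 1 else 0 else 0) -
      (if w = l then if v = j then 1 else 0 else 0) -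
      (if w = j then if v = l then 1 else 0 else 0) := by
    intro w
    have h3 := G.adj_comm l j
    have h4 := G.adj_comm l i
    simp only [hG', Sym2.eq_iff, ne_eq]
    by_cases a1 : w = l <;> by_cases a2 : v = l
    · subst a1 a2; simp_all
    · subst a1
      by_cases a3 : v = i
      · subst a3; simp_all
      · by_cases a4 : v = j
        · subst a4; simp_all
        · simp_all
    · subst a2
      by_cases a3 : w = i
      · subst a3; simp_all
      · by_cases a4 : w = j
        · subst a4; simp_all
        · simp_all
    · simp_all
  rw [degR_eq_sum, degR_eq_sum, Finset.sum_congr rfl fun w _ => key w]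
  simp only [Finset.sum_sub_distrib, Finset.sum_add_distrib, Finset.sum_ite_eq', Finset.mem_univ,
    if_true]
  ring

theorem pow_succ_sub_pow_lt (m : ℕ) {s t : ℝ} (hs : 0 ≤ s) (hst : s < t) :
    (s + 1) ^ (m + 2) - s ^ (m + 2) < (t + 1) ^ (m + 2) - t ^ (m + 2) := by
  induction m with
  | zero =>
    change (s + 1) ^ 2 - s ^ 2 < (t + 1) ^ 2 - t ^ 2
    linarith [add_sq s 1, add_sq t 1]
  | succ m ih =>
    have h1 : s ^ (m + 2) ≤ t ^ (m + 2) := by gcongr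
    have h2 : 0 ≤ (s + 1) ^ (m + 2) - s ^ (m + 2) :=
      sub_nonneg.2 (pow_le_pow_left₀ hs (by linarith) _)
    rw [show m + 1 + 2 = m + 2 + 1 from rfl, pow_succ, pow_succ _ (m + 2), pow_succ _ (m + 2),
      pow_succ _ (m + 2)]
    nlinarith

theorem pow_succ_sub_pow_le (m : ℕ) {s t : ℝ} (hs : 0 ≤ s) (hst : s ≤ t) :
    (s + 1) ^ (m + 2) - s ^ (m + 2) ≤ (t + 1) ^ (m + 2) - t ^ (m + 2) := by
  rcases hst.eq_or_lt with rfl | h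
  · rfl
  · exact (pow_succ_sub_pow_lt m hs h).le

/-- Shifting an edge towards a vertex of larger degree increases the number of stars. -/
theorem sum_pow_lt_of_shift {n : ℕ} (m : ℕ) (d d' : Fin n → ℝ) {i j : Fin n} (hij : i ≠ j)
    (hj : 1 ≤ d j) (hle : d j ≤ d i)
    (h : ∀ v, d' v = d v + (if v = i then 1 else 0) - (if v = j then 1 else 0)) :
    ∑ v, d v ^ (m + 2) < ∑ v, d' v ^ (m + 2) := by
  have key : ∀ v, d' v ^ (m + 2) = d v ^ (m + 2) +
      (if v = i then (d i + 1) ^ (m + 2) - d i ^ (m + 2) else 0) -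
      (if v = j then d j ^ (m + 2) - (d j - 1) ^ (m + 2) else 0) := by
    intro v
    rw [h]
    by_cases h1 : v = i
    · subst h1; simp [hij]
    · by_cases h2 : v = j
      · subst h2; simp [h1]
      · simp [h1, h2]
  have := pow_succ_sub_pow_lt m (s := d j - 1) (t := d i) (by linarith) (by linarith)
  simp only [key, Finset.sum_sub_distrib, Finset.sum_add_distrib, Finset.sum_ite_eq',
    Finset.mem_univ, if_true]
  rw [sub_add_cancel] at this
  linarith

theorem degR_comap {n : ℕ} (G : SimpleGraph (Fin n)) (σ : Equiv.Perm (Fin n)) (v : Fin n) :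
    degR (G.comap σ) v = degR G (σ v) := by
  classical
  rw [degR_eq_sum, degR_eq_sum, ← Equiv.sum_comp σ fun w => if G.Adj (σ v) w then (1 : ℝ) else 0]
  exact Finset.sum_congr rfl fun w _ => if_congr Iff.rfl rfl rfl

theorem one_le_degR {n : ℕ} (G : SimpleGraph (Fin n)) {v w : Fin n} (h : G.Adj v w) :
    1 ≤ degR G v := by
  have : Nonempty (G.neighborSet v) := ⟨⟨w, h⟩⟩
  have h := Nat.card_pos (α := G.neighborSet v)
  rw [degR]
  exact_mod_cast h

/-- Among the graphs with given numbers of vertices and edges, the number of stars is maximal for a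
threshold graph. -/
theorem exists_threshold {n : ℕ} (m : ℕ) (G : SimpleGraph (Fin n)) : ∃ H : SimpleGraph (Fin n),
    ∑ v, degR H v = ∑ v, degR G v ∧ ∑ v, degR G v ^ (m + 2) ≤ ∑ v, degR H v ^ (m + 2) ∧
    Antitone (degR H) ∧ ∀ i j l, i < j → l ≠ i → l ≠ j → H.Adj l j → H.Adj l i := by
  classical
  obtain ⟨H, hH, hmax⟩ := Set.exists_max_image
    {H : SimpleGraph (Fin n) | ∑ v, degR H v = ∑ v, degR G v}
    (fun H => ∑ v, degR H v ^ (m + 2)) (Set.toFinite _) ⟨G, rfl⟩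
  obtain ⟨σ, hσ⟩ : ∃ σ : Equiv.Perm (Fin n), Antitone fun v => degR H (σ v) := by
    refine ⟨Tuple.sort fun v => -degR H v, fun a b hab => ?_⟩
    exact neg_le_neg_iff.1 (Tuple.monotone_sort (fun v => -degR H v) hab)
  have hd : degR (H.comap σ) = fun v => degR H (σ v) := funext fun v => degR_comap H σ v
  refine ⟨H.comap σ, ?_, ?_, hd ▸ hσ, fun i j l hij hli hlj hadj => ?_⟩
  · rw [hd, Equiv.sum_comp σ (degR H)]
    exact hH
  · rw [hd, Equiv.sum_comp σ fun v => degR H v ^ (m + 2)]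
    exact hmax G rfl
  · by_contra hn
    obtain ⟨H', hH'⟩ := exists_shift H (σ.injective.ne hij.ne) (σ.injective.ne hli)
      (σ.injective.ne hlj) hadj hn
    have h1 := sum_pow_lt_of_shift m (degR H) (degR H') (σ.injective.ne hij.ne)
      (one_le_degR H hadj.symm) (hσ hij.le) hH'
    refine absurd (hmax H' ?_) (not_le.2 h1)
    simp only [Set.mem_ofPred_eq] at hH ⊢
    rw [← hH]
    simp [hH', Finset.sum_sub_distrib, Finset.sum_add_distrib]

/-- A threshold graph splits into a clique and an independent set. -/
theorem exists_split {n : ℕ} (H : SimpleGraph (Fin n))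
    (hH : ∀ i j l, i < j → l ≠ i → l ≠ j → H.Adj l j → H.Adj l i) :
    ∃ c ≤ n, (∀ i j : Fin n, (i : ℕ) < c → (j : ℕ) < c → i ≠ j → H.Adj i j) ∧
      ∀ i j : Fin n, c ≤ (i : ℕ) → c ≤ (j : ℕ) → ¬ H.Adj i j := by
  classical
  have hex : ∃ t : ℕ, ∀ ht : t < n, ∃ i : Fin n, (i : ℕ) < t ∧ ¬ H.Adj i ⟨t, ht⟩ :=
    ⟨n, fun h => absurd h (lt_irrefl _)⟩
  obtain ⟨c, hc, hmin⟩ : ∃ c : ℕ, (∀ ht : c < n, ∃ i : Fin n, (i : ℕ) < c ∧ ¬ H.Adj i ⟨c, ht⟩) ∧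
      ∀ t < c, ¬ ∀ ht : t < n, ∃ i : Fin n, (i : ℕ) < t ∧ ¬ H.Adj i ⟨t, ht⟩ :=
    ⟨Nat.find hex, Nat.find_spec hex, fun t => Nat.find_min hex⟩
  have hcl : ∀ i j : Fin n, i < j → (j : ℕ) < c → H.Adj i j := by
    intro i j hij hj
    by_contra hn
    exact hmin j hj fun _ => ⟨i, hij, hn⟩
  have hind : ∀ i j : Fin n, i < j → c ≤ (i : ℕ) → ¬ H.Adj i j := by
    intro i j hij hi hadj
    have hcn : c < n := hi.trans_lt i.2
    obtain ⟨i₀, h0, hn⟩ := hc hcn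
    have h1 : i₀ < i := Fin.lt_def.2 (h0.trans_le hi)
    have h2 := hH i₀ i j h1 (h1.trans hij).ne' hij.ne' hadj.symm
    have h3 : (⟨c, hcn⟩ : Fin n) < j := Fin.lt_def.2 (hi.trans_lt hij)
    exact hn (hH _ j i₀ h3 (Fin.lt_def.2 h0).ne (h1.trans hij).ne h2.symm)
  refine ⟨c, ?_, fun i j hi hj hij => ?_, fun i j hi hj hadj => ?_⟩
  · by_contra! h
    exact hmin n h fun h' => absurd h' (lt_irrefl _)
  · rcases lt_or_gt_of_ne hij with h | h
    · exact hcl i j h hj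
    · exact (hcl j i h hi).symm
  · rcases lt_or_gt_of_ne hadj.ne with h | h
    · exact hind i j h hi hadj
    · exact hind j i h hj hadj.symm

theorem add_card_pow_le (m c : ℕ) (N : Finset ℕ) (hN : ∀ j ∈ N, c ≤ j) :
    ((c : ℝ) + N.card) ^ (m + 2) ≤
      (c : ℝ) ^ (m + 2) + ∑ j ∈ N, (((j : ℝ) + 1) ^ (m + 2) - (j : ℝ) ^ (m + 2)) := by
  induction N using Finset.induction_on_max with
  | empty => simp
  | insert a s hs ih =>
    have ha : a ∉ s := fun h => lt_irrefl _ (hs a h)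
    have h1 := ih fun j hj => hN j (Finset.mem_insert_of_mem hj)
    have h2 : s.card ≤ a - c := by
      rw [← Nat.card_Ico]
      exact Finset.card_le_card fun x hx =>
        Finset.mem_Ico.2 ⟨hN x (Finset.mem_insert_of_mem hx), hs x hx⟩
    have h3 : c ≤ a := hN a (Finset.mem_insert_self _ _)
    have h4 : (c : ℝ) + s.card ≤ a := by exact_mod_cast (show c + s.card ≤ a by omega)
    have h5 := pow_succ_sub_pow_le m (by positivity) h4
    rw [Finset.sum_insert ha, Finset.card_insert_of_notMem ha]
    push_cast
    rw [← add_assoc]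
    linarith

theorem sum_ite_lt_telescope {n s : ℕ} (hs : s ≤ n) (F : ℕ → ℝ) :
    ∑ j : Fin n, (if (j : ℕ) < s then F (j + 1) - F j else 0) = F s - F 0 := by
  rw [Fin.sum_univ_eq_sum_range fun j => if j < s then F (j + 1) - F j else 0, ← Finset.sum_filter,
    ← Finset.sum_range_sub F s]
  congr 1
  ext j
  simp only [Finset.mem_filter, Finset.mem_range]
  omega

theorem sum_ite_lt_const {n s : ℕ} (hs : s ≤ n) (x : ℝ) :
    ∑ j : Fin n, (if (j : ℕ) < s then x else 0) = s * x := by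
  have := sum_ite_lt_telescope hs fun j => j * x
  simpa [add_mul] using this

/-- Bound for the number of stars in a graph which is split into a clique and an independent set, in terms
of the degrees in the independent set. -/
theorem split_bound {n : ℕ} (m c : ℕ) (hcn : c ≤ n) (H : SimpleGraph (Fin n))
    (hcl : ∀ i j : Fin n, (i : ℕ) < c → (j : ℕ) < c → i ≠ j → H.Adj i j)
    (hind : ∀ i j : Fin n, c ≤ (i : ℕ) → c ≤ (j : ℕ) → ¬ H.Adj i j)
    (g : Fin n → ℝ) (hg : g = fun j : Fin n => if (j : ℕ) < c then (c : ℝ) else degR H j) :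
    (∀ j, g j ≤ c) ∧ (∑ v, degR H v) + c = 2 * (∑ j, g j) - (c : ℝ) ^ 2 ∧
    ∑ v, degR H v ^ (m + 2) ≤
      (∑ j, (g j * (((j : ℝ) + 1) ^ (m + 2) - (j : ℝ) ^ (m + 2)) + g j ^ (m + 2))) -
        (c : ℝ) ^ (m + 3) := by
  classical
  obtain ⟨Δ, hΔ⟩ : ∃ Δ : ℕ → ℝ, Δ = fun (j : ℕ) => ((j : ℝ) + 1) ^ (m + 2) - (j : ℝ) ^ (m + 2) := ⟨_, rfl⟩
  obtain ⟨A, hA⟩ : ∃ A : Fin n → Fin n → ℝ, A = fun i j => if H.Adj i j then 1 else 0 := ⟨_, rfl⟩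
  obtain ⟨r, hr⟩ : ∃ r : Fin n → ℝ, r = fun i => ∑ j : Fin n, if (j : ℕ) < c then 0 else A i j := ⟨_, rfl⟩
  have hdeg : ∀ i, degR H i = ∑ j, A i j := fun i => by rw [degR_eq_sum, hA]
  have hsymm : ∀ i j, A i j = A j i := fun i j => by simp [hA, H.adj_comm]
  have hdeg_ind : ∀ j : Fin n, ¬ (j : ℕ) < c → degR H j = ∑ i : Fin n, if (i : ℕ) < c then A i j else 0 := by
    intro j hj
    rw [hdeg]
    refine Finset.sum_congr rfl fun i _ => ?_
    rw [hsymm]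
    split_ifs with h
    · rfl
    · simp [hA, hind i j (not_lt.1 h) (not_lt.1 hj)]
  have hdeg_cl : ∀ i : Fin n, (i : ℕ) < c → degR H i + 1 = c + r i := by
    intro i hi
    have h1 : ∑ j, (A i j + if j = i then 1 else 0) =
        ∑ j : Fin n, ((if (j : ℕ) < c then 1 else 0) + if (j : ℕ) < c then 0 else A i j) := by
      refine Finset.sum_congr rfl fun j _ => ?_
      by_cases hj : (j : ℕ) < c
      · by_cases hij : j = i
        · subst hij; simp [hA, hj]
        · simp [hA, hj, hij, hcl i j hi hj (Ne.symm hij)]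
      · have hij : j ≠ i := fun h => hj (h ▸ hi)
        simp [hj, hij]
    rw [Finset.sum_add_distrib, Finset.sum_add_distrib, sum_ite_lt_const hcn, Finset.sum_ite_eq',
      ← hdeg] at h1
    simpa [hr] using h1
  have hswap : ∀ x : ℕ → ℝ, (∑ i : Fin n, if (i : ℕ) < c then
      ∑ j : Fin n, (if (j : ℕ) < c then 0 else A i j) * x j else 0) =
      ∑ j : Fin n, if (j : ℕ) < c then 0 else degR H j * x j := by
    intro x
    have h1 : ∀ i : Fin n, (if (i : ℕ) < c then
        ∑ j : Fin n, (if (j : ℕ) < c then 0 else A i j) * x j else 0) =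
        ∑ j : Fin n, if (j : ℕ) < c then 0 else (if (i : ℕ) < c then A i j else 0) * x j := by
      intro i
      split_ifs
      · exact Finset.sum_congr rfl fun j _ => by split_ifs <;> simp
      · simp
    rw [Finset.sum_congr rfl fun i _ => h1 i, Finset.sum_comm]
    refine Finset.sum_congr rfl fun j _ => ?_
    split_ifs with hj
    · simp
    · rw [hdeg_ind j hj, Finset.sum_mul]
  have hgsplit : ∀ x : ℕ → ℝ, ∑ j : Fin n, g j * x j =
      (∑ j : Fin n, if (j : ℕ) < c then c * x j else 0) +
        ∑ j : Fin n, if (j : ℕ) < c then 0 else degR H j * x j := by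
    intro x
    rw [← Finset.sum_add_distrib]
    refine Finset.sum_congr rfl fun j _ => ?_
    by_cases hj : (j : ℕ) < c <;> simp [hg, hj]
  refine ⟨fun j => ?_, ?_, ?_⟩
  · rw [hg]
    simp only
    split_ifs with hj
    · exact le_rfl
    · have h1 := sum_ite_lt_const hcn 1
      rw [mul_one] at h1
      rw [hdeg_ind j hj, ← h1]
      refine Finset.sum_le_sum fun i _ => ?_
      by_cases h : (i : ℕ) < c <;> by_cases h' : H.Adj i j <;> simp [hA, h, h']
  · have h1 : ∑ v, (degR H v + if (v : ℕ) < c then 1 else 0) =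
        ∑ v : Fin n, (g v + if (v : ℕ) < c then r v else 0) := by
      refine Finset.sum_congr rfl fun v _ => ?_
      by_cases hv : (v : ℕ) < c
      · simp [hg, hv, hdeg_cl v hv]
      · simp [hg, hv]
    rw [Finset.sum_add_distrib, Finset.sum_add_distrib, sum_ite_lt_const hcn] at h1
    have h2 := hswap fun _ => 1
    have h3 := hgsplit fun _ => 1
    simp only [mul_one] at h1 h2 h3
    rw [sum_ite_lt_const hcn] at h3
    rw [hr] at h1
    linarith
  · have hr' : ∀ i : Fin n, (i : ℕ) < c →
        (c + r i) ^ (m + 2) ≤ (c : ℝ) ^ (m + 2) + ∑ j : Fin n, (if (j : ℕ) < c then 0 else A i j) * Δ j := by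
      intro i hi
      have h1 := add_card_pow_le m c
        ((Finset.univ.filter fun j : Fin n => ¬ (j : ℕ) < c ∧ H.Adj i j).map Fin.valEmbedding)
        (fun j hj => by
          obtain ⟨j, hj', rfl⟩ := Finset.mem_map.1 hj
          exact not_lt.1 (Finset.mem_filter.1 hj').2.1)
      rw [Finset.card_map, Finset.sum_map] at h1
      have h2 : r i = (Finset.univ.filter fun j : Fin n => ¬ (j : ℕ) < c ∧ H.Adj i j).card := by
        rw [hr, hA, ← Finset.sum_boole]
        refine Finset.sum_congr rfl fun j _ => ?_
        by_cases h : (j : ℕ) < c <;> simp [h]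
      rw [h2]
      refine h1.trans_eq ?_
      rw [Finset.sum_filter, hΔ, hA]
      congr 1
      refine Finset.sum_congr rfl fun j _ => ?_
      by_cases h : (j : ℕ) < c <;> simp [h]
    have h1 : ∑ v, degR H v ^ (m + 2) ≤ ∑ v : Fin n, ((if (v : ℕ) < c then (c : ℝ) ^ (m + 2) else 0) +
        (if (v : ℕ) < c then ∑ j : Fin n, (if (j : ℕ) < c then 0 else A v j) * Δ j else 0) +
        (g v ^ (m + 2) - if (v : ℕ) < c then (c : ℝ) ^ (m + 2) else 0)) := by
      refine Finset.sum_le_sum fun v _ => ?_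
      by_cases hv : (v : ℕ) < c
      · have h2 := hr' v hv
        have h3 := hdeg_cl v hv
        have h4 : degR H v ^ (m + 2) ≤ (c + r v) ^ (m + 2) :=
          pow_le_pow_left₀ (degR_nonneg _ _) (by linarith) _
        simp only [hg, hv, if_true]
        linarith
      · simp [hg, hv]
    rw [Finset.sum_add_distrib, Finset.sum_add_distrib, Finset.sum_sub_distrib,
      sum_ite_lt_const hcn, hswap Δ] at h1
    have h2 := hgsplit Δ
    have h3 : (∑ j : Fin n, if (j : ℕ) < c then c * Δ j else 0) = c * (c : ℝ) ^ (m + 2) := by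
      have := sum_ite_lt_telescope hcn fun j => c * (j : ℝ) ^ (m + 2)
      simpa [hΔ, mul_sub] using this
    have h4 : (c : ℝ) ^ (m + 3) = c * (c : ℝ) ^ (m + 2) := pow_succ' _ _
    rw [Finset.sum_add_distrib, h4]
    simp only [hΔ] at h1 h2 h3
    linarith

/-- A strictly convex function on the antitone sequences with prescribed sum is bounded by its values on
sequences with at most one value strictly between the extremes. -/
theorem exists_extreme {n : ℕ} (m c : ℕ) (C : ℝ) (w g : Fin n → ℝ) (hg : Antitone g)
    (h0 : ∀ j, 0 ≤ g j) (hC : ∀ j, g j ≤ C) (hgc : ∀ j : Fin n, (j : ℕ) < c → g j = C) :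
    ∃ f : Fin n → ℝ, Antitone f ∧ (∀ j, 0 ≤ f j) ∧ (∀ j, f j ≤ C) ∧
      (∀ j : Fin n, (j : ℕ) < c → f j = C) ∧ ∑ j, f j = ∑ j, g j ∧
      ∑ j, (g j * w j + g j ^ (m + 2)) ≤ ∑ j, (f j * w j + f j ^ (m + 2)) ∧
      ∀ i j, 0 < f i → f i < C → 0 < f j → f j < C → f i = f j := by
  classical
  let K : Set (Fin n → ℝ) := {f | Antitone f ∧ (∀ j, 0 ≤ f j) ∧ (∀ j, f j ≤ C) ∧
      (∀ j : Fin n, (j : ℕ) < c → f j = C) ∧ ∑ j, f j = ∑ j, g j}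
  have hKsub : K ⊆ Set.pi Set.univ fun _ => Set.Icc 0 C := fun f hf j _ => ⟨hf.2.1 j, hf.2.2.1 j⟩
  have hKc : IsClosed K := by
    have e : K = (⋂ (i : Fin n) (j : Fin n) (_ : i ≤ j), {f | f j ≤ f i}) ∩
        ((⋂ j : Fin n, {f | 0 ≤ f j}) ∩ ((⋂ j : Fin n, {f | f j ≤ C}) ∩
        ((⋂ (j : Fin n) (_ : (j : ℕ) < c), {f | f j = C}) ∩ {f | ∑ j, f j = ∑ j, g j}))) := by
      ext f
      simp [K, Antitone]
    rw [e]
    refine IsClosed.inter (isClosed_iInter fun i => isClosed_iInter fun j => isClosed_iInter fun _ =>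
      isClosed_le (by fun_prop) (by fun_prop)) (IsClosed.inter (isClosed_iInter fun j =>
      isClosed_le (by fun_prop) (by fun_prop)) (IsClosed.inter (isClosed_iInter fun j =>
      isClosed_le (by fun_prop) (by fun_prop)) (IsClosed.inter (isClosed_iInter fun j =>
      isClosed_iInter fun _ => isClosed_eq (by fun_prop) (by fun_prop))
      (isClosed_eq (by fun_prop) (by fun_prop)))))
  have hKcomp : IsCompact K :=
    (isCompact_univ_pi fun _ => isCompact_Icc).of_isClosed_subset hKc hKsub
  obtain ⟨f, hf, hmax⟩ := hKcomp.exists_isMaxOn (f := fun f => ∑ j, (f j * w j + f j ^ (m + 2)))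
    ⟨g, hg, h0, hC, hgc, rfl⟩ (by fun_prop)
  obtain ⟨f1, f2, f3, f4, f5⟩ := hf
  refine ⟨f, f1, f2, f3, f4, f5, hmax (show g ∈ K from ⟨hg, h0, hC, hgc, rfl⟩), ?_⟩
  intro a b ha1 ha2 hb1 hb2
  by_contra hab
  -- perturbation of the level sets of `f a` and `f b`
  obtain ⟨p, hp⟩ : ∃ p : ℝ, p = (Finset.univ.filter fun j => f j = f a).card := ⟨_, rfl⟩
  obtain ⟨q, hq⟩ : ∃ q : ℝ, q = (Finset.univ.filter fun j => f j = f b).card := ⟨_, rfl⟩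
  have hp0 : 0 < p := by
    rw [hp]; exact_mod_cast Finset.card_pos.2 ⟨a, by simp⟩
  have hq0 : 0 < q := by
    rw [hq]; exact_mod_cast Finset.card_pos.2 ⟨b, by simp⟩
  obtain ⟨φ, hφ⟩ : ∃ φ : ℝ → ℝ, φ = fun x => (if x = f a then q else 0) - (if x = f b then p else 0) :=
    ⟨_, rfl⟩
  have hφsum : ∑ j, φ (f j) = 0 := by
    simp only [hφ, Finset.sum_sub_distrib, ← Finset.sum_filter, Finset.sum_const, nsmul_eq_mul]
    rw [← hp, ← hq]
    ring
  have hφ0 : ∀ x, φ x ≠ 0 → x = f a ∨ x = f b := fun x hx => by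
    by_contra! h
    exact hx (by simp [hφ, h.1, h.2])
  have hφa : φ (f a) ≠ 0 := by simp [hφ, hab, hq0.ne']
  have hfeas : ∀ᶠ t : ℝ in nhds 0, (fun j => f j + t * φ (f j)) ∈ K := by
    have hlim : ∀ j, Filter.Tendsto (fun t : ℝ => f j + t * φ (f j)) (nhds 0) (nhds (f j)) := by
      intro j
      have : Continuous fun t : ℝ => f j + t * φ (f j) := by fun_prop
      simpa using this.tendsto 0
    have e1 : ∀ᶠ t : ℝ in nhds 0, ∀ i j, i ≤ j → f j + t * φ (f j) ≤ f i + t * φ (f i) := by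
      refine Filter.eventually_all.2 fun i => Filter.eventually_all.2 fun j => ?_
      by_cases hij : i ≤ j
      · rcases (f1 hij).eq_or_lt with h | h
        · exact Filter.Eventually.of_forall fun t _ => by rw [h]
        · exact ((hlim j).eventually_lt (hlim i) h).mono fun t ht _ => ht.le
      · exact Filter.Eventually.of_forall fun t h => absurd h hij
    have e2 : ∀ᶠ t : ℝ in nhds 0, ∀ j, 0 ≤ f j + t * φ (f j) ∧ f j + t * φ (f j) ≤ C := by
      refine Filter.eventually_all.2 fun j => ?_
      by_cases hj : φ (f j) = 0
      · exact Filter.Eventually.of_forall fun t => by simp [hj, f2 j, f3 j]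
      · have h1 : 0 < f j ∧ f j < C := by
          rcases hφ0 _ hj with h | h
          · rw [h]; exact ⟨ha1, ha2⟩
          · rw [h]; exact ⟨hb1, hb2⟩
        filter_upwards [(hlim j).eventually (lt_mem_nhds h1.1),
          (hlim j).eventually (gt_mem_nhds h1.2)] with t h2 h3 using ⟨h2.le, h3.le⟩
    filter_upwards [e1, e2] with t h1 h2
    refine ⟨fun i j hij => h1 i j hij, fun j => (h2 j).1, fun j => (h2 j).2, fun j hj => ?_, ?_⟩
    · have h0 : φ (f j) = 0 := by
        by_contra h
        rcases hφ0 _ h with h | h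
        · rw [f4 j hj] at h; exact ha2.ne h.symm
        · rw [f4 j hj] at h; exact hb2.ne h.symm
      change f j + t * φ (f j) = C
      rw [h0, mul_zero, add_zero, f4 j hj]
    · rw [Finset.sum_add_distrib, ← Finset.mul_sum, hφsum, mul_zero, add_zero, f5]
  have hneg : ∀ᶠ t : ℝ in nhds 0, (fun j => f j + -t * φ (f j)) ∈ K := by
    have : Filter.Tendsto (fun t : ℝ => -t) (nhds 0) (nhds 0) := by
      simpa using (continuous_neg (G := ℝ)).tendsto 0
    exact this.eventually hfeas
  obtain ⟨t, ⟨hK1, hK2⟩, ht0⟩ : ∃ t : ℝ, ((fun j => f j + t * φ (f j)) ∈ K ∧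
      (fun j => f j + -t * φ (f j)) ∈ K) ∧ t ≠ 0 := by
    have := ((hfeas.and hneg).filter_mono (nhdsWithin_le_nhds (s := {0}ᶜ))).and
      (self_mem_nhdsWithin)
    exact this.exists
  have m1 := hmax hK1
  have m2 := hmax hK2
  have hconv := strictConvexOn_pow (n := m + 2) (by omega)
  have hmid : ∀ j, 2 * f j ^ (m + 2) ≤ (f j + t * φ (f j)) ^ (m + 2) + (f j + -t * φ (f j)) ^ (m + 2) ∧
      (φ (f j) ≠ 0 → 2 * f j ^ (m + 2) <
        (f j + t * φ (f j)) ^ (m + 2) + (f j + -t * φ (f j)) ^ (m + 2)) := by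
    intro j
    have hs : φ (f j) ≠ 0 → 2 * f j ^ (m + 2) <
        (f j + t * φ (f j)) ^ (m + 2) + (f j + -t * φ (f j)) ^ (m + 2) := fun h => by
      have hne : f j + t * φ (f j) ≠ f j + -t * φ (f j) := fun h' => by
        have : t * φ (f j) = 0 := by linarith
        exact (mul_ne_zero ht0 h) this
      have := hconv.2 (show f j + t * φ (f j) ∈ Set.Ici 0 from hK1.2.1 j)
        (show f j + -t * φ (f j) ∈ Set.Ici 0 from hK2.2.1 j) hne
        (show (0 : ℝ) < 1 / 2 by norm_num) (show (0 : ℝ) < 1 / 2 by norm_num) (by norm_num)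
      simp only [smul_eq_mul] at this
      rw [show 1 / 2 * (f j + t * φ (f j)) + 1 / 2 * (f j + -t * φ (f j)) = f j by ring] at this
      linarith
    refine ⟨?_, hs⟩
    by_cases h : φ (f j) = 0
    · simp [h]; linarith
    · exact (hs h).le
  have hlt : ∑ j, 2 * (f j * w j + f j ^ (m + 2)) <
      ∑ j, (((f j + t * φ (f j)) * w j + (f j + t * φ (f j)) ^ (m + 2)) +
        ((f j + -t * φ (f j)) * w j + (f j + -t * φ (f j)) ^ (m + 2))) := by
    refine Finset.sum_lt_sum (fun j _ => ?_) ⟨a, Finset.mem_univ _, ?_⟩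
    · linarith [(hmid j).1]
    · linarith [(hmid a).2 hφa]
  rw [← Finset.mul_sum, Finset.sum_add_distrib (g := fun j =>
    (f j + -t * φ (f j)) * w j + (f j + -t * φ (f j)) ^ (m + 2))] at hlt
  simp only [Set.mem_ofPred_eq] at m1 m2
  linarith

theorem exists_initial_segment {n : ℕ} (P : Fin n → Prop) (hP : ∀ i j, i ≤ j → P j → P i) :
    ∃ s ≤ n, ∀ j : Fin n, P j ↔ (j : ℕ) < s := by
  classical
  by_cases h : ∃ j, ¬ P j
  · have hex : ∃ t : ℕ, ∃ ht : t < n, ¬ P ⟨t, ht⟩ := let ⟨j, hj⟩ := h; ⟨j, j.2, hj⟩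
    obtain ⟨ht, hn⟩ := Nat.find_spec hex
    refine ⟨Nat.find hex, ht.le, fun j => ⟨fun hj => ?_, fun hj => ?_⟩⟩
    · by_contra! hle
      exact hn (hP _ j hle hj)
    · by_contra hn'
      exact Nat.find_min hex hj ⟨j.2, hn'⟩
  · push Not at h
    exact ⟨n, le_rfl, fun j => ⟨fun _ => j.2, fun _ => h j⟩⟩

theorem sum_two_step {n s r : ℕ} (hsr : s ≤ r) (hr : r ≤ n) (a b : ℝ) (F : ℕ → ℝ) :
    ∑ j : Fin n, (if (j : ℕ) < s then a else if (j : ℕ) < r then b else 0) * (F (j + 1) - F j) =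
      a * (F s - F 0) + b * (F r - F s) := by
  have h1 := sum_ite_lt_telescope (hsr.trans hr) F
  have h2 := sum_ite_lt_telescope hr F
  have h3 : ∀ j : Fin n, (if (j : ℕ) < s then a else if (j : ℕ) < r then b else 0) *
      (F (j + 1) - F j) = (a - b) * (if (j : ℕ) < s then F (j + 1) - F j else 0) +
        b * (if (j : ℕ) < r then F (j + 1) - F j else 0) := by
    intro j
    by_cases h : (j : ℕ) < s
    · simp only [h, h.trans_le hsr, if_true]; ring
    · by_cases h' : (j : ℕ) < r
      · simp only [h, h', if_true, if_false]; ring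
      · simp only [h, h', if_false]; ring
  rw [Finset.sum_congr rfl fun j _ => h3 j, Finset.sum_add_distrib, ← Finset.mul_sum,
    ← Finset.mul_sum, h1, h2]
  ring

/-- The upper bound for the number of stars of a finite graph. -/
theorem starDensity_le_max (m : ℕ) {n : ℕ} (hn : 0 < n) (G : SimpleGraph (Fin n)) :
    ∃ δ : ℝ, 0 ≤ δ ∧ δ ≤ 1 / n ∧ starDensity (m + 2) G ≤
      max (anticliqueBranch (m + 2) (starDensity 1 G + δ))
        (cliqueBranch (m + 2) (starDensity 1 G + δ)) := by
  obtain ⟨H, hsum, hpow, hanti, hnest⟩ := exists_threshold m G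
  obtain ⟨c, hcn, hcl, hind⟩ := exists_split H hnest
  obtain ⟨g, hg⟩ : ∃ g : Fin n → ℝ, g = fun j : Fin n => if (j : ℕ) < c then (c : ℝ) else degR H j :=
    ⟨_, rfl⟩
  obtain ⟨hgc, hedge, hstar⟩ := split_bound m c hcn H hcl hind g hg
  have hganti : Antitone g := fun i j hij => by
    by_cases hj : (j : ℕ) < c
    · have hi : (i : ℕ) < c := lt_of_le_of_lt hij hj
      simp [hg, hi, hj]
    · by_cases hi : (i : ℕ) < c
      · have := hgc j
        simp only [hg, hi, if_true] at this ⊢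
        exact this
      · simpa [hg, hi, hj] using hanti hij
  have hg0 : ∀ j, 0 ≤ g j := fun j => by
    by_cases hj : (j : ℕ) < c
    · simp [hg, hj]
    · simp [hg, hj, degR_nonneg]
  obtain ⟨f, fanti, f0, fc, ftop, fsum, fle, flev⟩ := exists_extreme m c c
    (fun j => ((j : ℝ) + 1) ^ (m + 2) - (j : ℝ) ^ (m + 2)) g hganti hg0 hgc
    (fun j hj => by simp [hg, hj])
  obtain ⟨s, hsn, hs⟩ := exists_initial_segment (fun j => f j = c)
    fun i j hij hj => le_antisymm (fc i) (hj ▸ fanti hij)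
  obtain ⟨r, hrn, hr⟩ := exists_initial_segment (fun j => f j = c ∨ 0 < f j) fun i j hij hj => by
    rcases hj with hj | hj
    · exact Or.inl (le_antisymm (fc i) (hj ▸ fanti hij))
    · exact Or.inr (hj.trans_le (fanti hij))
  have hsr : s ≤ r := by
    by_contra! h
    have h1 := (hs ⟨r, h.trans_le hsn⟩).2 h
    exact lt_irrefl _ ((hr ⟨r, h.trans_le hsn⟩).1 (Or.inl h1))
  have hcs : c ≤ s := by
    by_contra! h
    exact lt_irrefl _ ((hs ⟨s, h.trans_le hcn⟩).1 (ftop _ h))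
  obtain ⟨v, hv0, hvc, hfv⟩ : ∃ v : ℝ, 0 ≤ v ∧ v ≤ c ∧
      f = fun j : Fin n => if (j : ℕ) < s then (c : ℝ) else if (j : ℕ) < r then v else 0 := by
    have hmid : ∀ j : Fin n, ¬ (j : ℕ) < s → (j : ℕ) < r → 0 < f j ∧ f j < c := by
      intro j h1 h2
      have h3 : f j ≠ c := fun h => h1 ((hs j).1 h)
      exact ⟨((hr j).2 h2).resolve_left h3, lt_of_le_of_ne (fc j) h3⟩
    have hend : ∀ j : Fin n, ¬ (j : ℕ) < r → f j = 0 := by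
      intro j h1
      refine le_antisymm ?_ (f0 j)
      by_contra! h
      exact h1 ((hr j).1 (Or.inr h))
    by_cases hsr' : s < r
    · obtain ⟨h1, h2⟩ := hmid ⟨s, hsr'.trans_le hrn⟩ (lt_irrefl _) hsr'
      refine ⟨f ⟨s, hsr'.trans_le hrn⟩, f0 _, fc _, funext fun j => ?_⟩
      split_ifs with h3 h4
      · exact (hs j).2 h3
      · exact flev _ _ (hmid j h3 h4).1 (hmid j h3 h4).2 h1 h2
      · exact hend j h4
    · refine ⟨0, le_rfl, Nat.cast_nonneg _, funext fun j => ?_⟩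
      split_ifs with h3 h4
      · exact (hs j).2 h3
      · exact absurd (h4.trans_le (not_lt.1 hsr')) h3
      · exact hend j h4
  have hn' : (0 : ℝ) < n := by exact_mod_cast hn
  have hsumf : ∑ j, f j = c * s + v * (r - s) := by
    have := sum_two_step hsr hrn (c : ℝ) v fun j => (j : ℝ)
    rw [hfv]
    simpa using this
  have hsum1 : ∑ j : Fin n, f j * (((j : ℝ) + 1) ^ (m + 2) - (j : ℝ) ^ (m + 2)) =
      c * (s : ℝ) ^ (m + 2) + v * ((r : ℝ) ^ (m + 2) - (s : ℝ) ^ (m + 2)) := by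
    have := sum_two_step hsr hrn (c : ℝ) v fun j => (j : ℝ) ^ (m + 2)
    rw [hfv]
    simpa using this
  have hsum2 : ∑ j : Fin n, f j ^ (m + 2) =
      (c : ℝ) ^ (m + 2) * s + v ^ (m + 2) * (r - s) := by
    have := sum_two_step hsr hrn ((c : ℝ) ^ (m + 2)) (v ^ (m + 2)) fun j => (j : ℝ)
    rw [hfv]
    have h0 : (0 : ℝ) ^ (m + 2) = 0 := by simp
    simpa [ite_pow] using this
  have fle := fle.trans_eq (by rw [Finset.sum_add_distrib, hsum1, hsum2])
  have key := split_four_le m (v := v / n) (c := c / n) (s := s / n) (r := r / n) (by positivity)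
    (by gcongr) (by gcongr) (by gcongr) ((div_le_one hn').2 (by exact_mod_cast hrn))
  refine ⟨c / (n : ℝ) ^ 2, by positivity, ?_, ?_⟩
  · rw [div_le_div_iff₀ (by positivity) hn']
    have : (c : ℝ) ≤ n := by exact_mod_cast hcn
    nlinarith
  have hx : starDensity 1 G + c / (n : ℝ) ^ 2 =
      2 * (c / n) * (s / n) - (c / n) ^ 2 + 2 * (v / n) * (r / n - s / n) := by
    rw [starDensity_eq]
    simp only [pow_one]
    rw [← hsum, eq_sub_of_add_eq hedge, ← fsum, hsumf]
    field_simp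
    ring
  rw [hx]
  refine le_trans ?_ key
  rw [starDensity_eq, div_le_iff₀ (by positivity)]
  refine hpow.trans (hstar.trans ((sub_le_sub_right fle _).trans_eq ?_))
  simp only [div_pow]
  field_simp
  ring

theorem pow_starDensity_one_le (k : ℕ) {n : ℕ} (hn : 0 < n) (G : SimpleGraph (Fin n)) :
    starDensity 1 G ^ (k + 1) ≤ starDensity (k + 1) G := by
  have hn' : (0 : ℝ) < n := by exact_mod_cast hn
  have h := pow_sum_div_card_le_sum_pow (s := Finset.univ) (f := degR G) (fun i _ => degR_nonneg G i) k
  rw [Finset.card_univ, Fintype.card_fin, div_le_iff₀ (by positivity)] at h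
  rw [starDensity_eq, starDensity_eq, div_pow, div_le_div_iff₀ (by positivity) (by positivity)]
  simp only [pow_one]
  refine (mul_le_mul_of_nonneg_right h (by positivity)).trans_eq ?_
  ring

theorem anticliqueBranch_continuous (k : ℕ) : Continuous (anticliqueBranch k) := by
  unfold anticliqueBranch
  fun_prop

theorem cliqueBranch_continuous (k : ℕ) : Continuous (cliqueBranch k) := by
  unfold cliqueBranch
  exact Real.continuous_rpow_const (by positivity)

theorem le_max_of_mem_phaseSpace (m : ℕ) {ε τ : ℝ} (h : (ε, τ) ∈ phaseSpace (m + 2)) :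
    τ ≤ max (anticliqueBranch (m + 2) ε) (cliqueBranch (m + 2) ε) := by
  by_contra! hlt
  obtain ⟨M, hM⟩ : ∃ M : ℝ → ℝ, M = fun x =>
    max (anticliqueBranch (m + 2) x) (cliqueBranch (m + 2) x) := ⟨_, rfl⟩
  have hMc : Continuous M := by
    rw [hM]
    exact (anticliqueBranch_continuous _).max (cliqueBranch_continuous _)
  have hopen : IsOpen {q : (ℝ × ℝ) × ℝ | M (q.1.1 + q.2) < q.1.2} :=
    isOpen_lt (by fun_prop) (by fun_prop)
  have hmem : {q : (ℝ × ℝ) × ℝ | M (q.1.1 + q.2) < q.1.2} ∈ nhds ((ε, τ), (0 : ℝ)) :=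
    hopen.mem_nhds (by simpa [hM] using hlt)
  rw [nhds_prod_eq, Filter.mem_prod_iff] at hmem
  obtain ⟨U, hU, D, hD, hsub⟩ := hmem
  obtain ⟨η, hη, hball⟩ := Metric.mem_nhds_iff.1 hD
  obtain ⟨N, hN⟩ := exists_nat_one_div_lt hη
  have hinf := Set.Infinite.of_accPt (AccPt.nhds_inter h hU)
  refine hinf ((Set.finite_iUnion fun n : Fin (N + 1) => Set.finite_range
    fun G : SimpleGraph (Fin n) => (starDensity 1 G, starDensity (m + 2) G)).subset ?_)
  rintro p ⟨hpU, n, hn, G, rfl⟩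
  have hnN : n < N + 1 := by
    by_contra! hle
    obtain ⟨δ, hδ0, hδ1, hle'⟩ := starDensity_le_max m hn G
    have hδ : δ ∈ D := by
      refine hball ?_
      rw [Metric.mem_ball, dist_zero_right, Real.norm_of_nonneg hδ0]
      refine (hδ1.trans ?_).trans_lt hN
      have : (N : ℝ) + 1 ≤ n := by exact_mod_cast hle
      gcongr
    have := hsub (Set.mk_mem_prod hpU hδ)
    simp only [hM, Set.mem_ofPred_eq] at this
    linarith
  exact Set.mem_iUnion.2 ⟨⟨n, hnN⟩, G, rfl⟩

theorem pow_le_of_mem_phaseSpace (k : ℕ) {ε τ : ℝ} (h : (ε, τ) ∈ phaseSpace (k + 1)) :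
    ε ^ (k + 1) ≤ τ := by
  have hcl : IsClosed {p : ℝ × ℝ | p.1 ^ (k + 1) ≤ p.2} := isClosed_le (by fun_prop) (by fun_prop)
  have hsub : densityPairs (k + 1) ⊆ {p : ℝ × ℝ | p.1 ^ (k + 1) ≤ p.2} := by
    rintro p ⟨n, hn, G, rfl⟩
    exact pow_starDensity_one_le k hn G
  exact closure_minimal hsub hcl (mem_closure_iff_clusterPt.2 (AccPt.clusterPt h))

theorem sum_pow_near {n : ℕ} (k : ℕ) (d D : Fin n → ℝ) (hd0 : ∀ v, 0 ≤ d v) (hdn : ∀ v, d v ≤ n)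
    (hD0 : ∀ v, 0 ≤ D v) (hDn : ∀ v, D v ≤ n) (h : ∀ v, |d v - D v| ≤ 2) (hn : 0 < n) :
    |(∑ v, d v ^ k) / (n : ℝ) ^ (k + 1) - (∑ v, D v ^ k) / (n : ℝ) ^ (k + 1)| ≤ 2 * k / n := by
  have hn' : (0 : ℝ) < n := by exact_mod_cast hn
  have hpow : ∀ v, |d v ^ k - D v ^ k| ≤ 2 * k * (n : ℝ) ^ (k - 1) := by
    intro v
    have h1 := abs_pow_sub_pow_le (d v) (D v) k
    rw [abs_of_nonneg (hd0 v), abs_of_nonneg (hD0 v)] at h1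
    refine h1.trans ?_
    have h2 : max (d v) (D v) ^ (k - 1) ≤ (n : ℝ) ^ (k - 1) :=
      pow_le_pow_left₀ (le_max_of_le_left (hd0 v)) (max_le (hdn v) (hDn v)) _
    have h3 : 0 ≤ max (d v) (D v) := le_max_of_le_left (hd0 v)
    have := h v
    gcongr
  rw [← sub_div, ← Finset.sum_sub_distrib, abs_div, abs_of_pos (by positivity : (0 : ℝ) < (n : ℝ) ^ (k + 1)),
    div_le_div_iff₀ (by positivity) hn']
  have h1 : |∑ v, (d v ^ k - D v ^ k)| ≤ n * (2 * k * (n : ℝ) ^ (k - 1)) := by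
    refine (Finset.abs_sum_le_sum_abs _ _).trans ((Finset.sum_le_sum fun v _ => hpow v).trans_eq ?_)
    simp
  refine (mul_le_mul_of_nonneg_right h1 hn'.le).trans_eq ?_
  rcases k with _ | k
  · simp
  · simp only [Nat.add_sub_cancel]
    ring

open Classical in
/-- The degree of a vertex with respect to a relation, which may contain loops. -/
noncomputable def relDeg {n : ℕ} (R : Fin n → Fin n → Prop) (v : Fin n) : ℝ :=
  ∑ w, if R v w then 1 else 0

theorem relDeg_nonneg {n : ℕ} (R : Fin n → Fin n → Prop) (v : Fin n) : 0 ≤ relDeg R v :=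
  Finset.sum_nonneg fun w _ => by split_ifs <;> norm_num

theorem relDeg_le {n : ℕ} (R : Fin n → Fin n → Prop) (v : Fin n) : relDeg R v ≤ n := by
  refine (Finset.sum_le_sum fun w _ => (show _ ≤ (1 : ℝ) by split_ifs <;> norm_num)).trans ?_
  simp

theorem starDensity_one_lt {n : ℕ} {G₁ G₂ : SimpleGraph (Fin (n + 1))}
    (h : ∀ v w, G₁.Adj v w → G₂.Adj v w) {a b : Fin (n + 1)} (h₁ : ¬ G₁.Adj a b) (h₂ : G₂.Adj a b) :
    starDensity 1 G₁ < starDensity 1 G₂ := by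
  classical
  rw [starDensity_eq, starDensity_eq]
  refine div_lt_div_of_pos_right ?_ (by positivity)
  simp only [pow_one, degR_eq_sum]
  have hle : ∀ v w, (if G₁.Adj v w then (1 : ℝ) else 0) ≤ if G₂.Adj v w then 1 else 0 := by
    intro v w
    by_cases h' : G₁.Adj v w
    · simp [h', h v w h']
    · rw [if_neg h']
      split_ifs <;> norm_num
  refine Finset.sum_lt_sum (fun v _ => Finset.sum_le_sum fun w _ => hle v w)
    ⟨a, Finset.mem_univ _, Finset.sum_lt_sum (fun w _ => hle a w) ⟨b, Finset.mem_univ _, ?_⟩⟩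
  simp [h₁, h₂]

open Classical in
/-- A symmetric relation is close to two graphs of different edge densities. -/
theorem exists_graph_pair {N : ℕ} (R : Fin (N + 2) → Fin (N + 2) → Prop) (hR : ∀ v w, R v w → R w v) :
    ∃ G₁ G₂ : SimpleGraph (Fin (N + 2)), (∀ v, |degR G₁ v - relDeg R v| ≤ 2) ∧
      (∀ v, |degR G₂ v - relDeg R v| ≤ 2) ∧ starDensity 1 G₁ < starDensity 1 G₂ := by
  let G₁ : SimpleGraph (Fin (N + 2)) := ⟨fun v w => v ≠ w ∧ R v w ∧ s(v, w) ≠ s(0, 1),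
    ⟨fun v w h => ⟨h.1.symm, hR _ _ h.2.1, by rw [Sym2.eq_swap]; exact h.2.2⟩⟩, ⟨fun v h => h.1 rfl⟩⟩
  let G₂ : SimpleGraph (Fin (N + 2)) := ⟨fun v w => v ≠ w ∧ (R v w ∨ s(v, w) = s(0, 1)),
    ⟨fun v w h => ⟨h.1.symm, h.2.imp (hR _ _) fun h' => by rw [Sym2.eq_swap]; exact h'⟩⟩,
    ⟨fun v h => h.1 rfl⟩⟩
  have hs : ∀ v w : Fin (N + 2), s(v, w) = s(0, 1) → w = if v = 0 then 1 else 0 := by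
    intro v w h
    rcases Sym2.eq_iff.1 h with ⟨rfl, rfl⟩ | ⟨rfl, rfl⟩ <;> simp
  have hclose : ∀ G : SimpleGraph (Fin (N + 2)),
      (∀ v w, v ≠ w → s(v, w) ≠ s(0, 1) → (G.Adj v w ↔ R v w)) →
      ∀ v, |degR G v - relDeg R v| ≤ 2 := by
    intro G hG v
    rw [degR_eq_sum, relDeg, ← Finset.sum_sub_distrib]
    have h1 : ∀ w, |(if G.Adj v w then (1 : ℝ) else 0) - (if R v w then 1 else 0)| ≤
        (if w = v then 1 else 0) + (if w = if v = 0 then 1 else 0 then 1 else 0) := by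
      intro w
      have h01 : |(if G.Adj v w then (1 : ℝ) else 0) - (if R v w then 1 else 0)| ≤ 1 := by
        split_ifs <;> norm_num
      by_cases a : w = v
      · rw [if_pos a]
        refine h01.trans (le_add_of_nonneg_right ?_)
        split_ifs <;> norm_num
      · by_cases b : w = if v = 0 then 1 else 0
        · rw [if_pos b, if_neg a, zero_add]
          exact h01
        · have := hG v w (Ne.symm a) fun h => b (hs v w h)
          simp [this, a, b]
    refine (Finset.abs_sum_le_sum_abs _ _).trans ((Finset.sum_le_sum fun w _ => h1 w).trans_eq ?_)
    rw [Finset.sum_add_distrib, Finset.sum_ite_eq', Finset.sum_ite_eq']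
    norm_num
  refine ⟨G₁, G₂, hclose G₁ fun v w h h' => ?_, hclose G₂ fun v w h h' => ?_, ?_⟩
  · exact ⟨fun h3 => h3.2.1, fun h3 => ⟨h, h3, h'⟩⟩
  · exact ⟨fun h3 => h3.2.resolve_right h', fun h3 => ⟨h, Or.inl h3⟩⟩
  · exact starDensity_one_lt (fun v w h => ⟨h.1, Or.inl h.2.1⟩) (a := 0) (b := 1)
      (fun h => h.2.2 rfl) ⟨by simp, Or.inr rfl⟩

/-- Limits of the densities of symmetric relations belong to the phase space. -/
theorem mem_phaseSpace_of_relations (k : ℕ) (R : ∀ n : ℕ, ℕ → Fin n → Fin n → Prop)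
    (hR : ∀ n M v w, R n M v w → R n M w v) (Φ₁ Φ : ℝ → ℝ) (hΦ₁ : Continuous Φ₁) (hΦ : Continuous Φ)
    (h₁ : ∀ n M : ℕ, 0 < n → M ≤ n → (∑ v, relDeg (R n M) v ^ 1) / (n : ℝ) ^ (1 + 1) = Φ₁ (M / n))
    (h : ∀ n M : ℕ, 0 < n → M ≤ n → (∑ v, relDeg (R n M) v ^ k) / (n : ℝ) ^ (k + 1) = Φ (M / n))
    {x : ℝ} (hx0 : 0 ≤ x) (hx1 : x ≤ 1) : (Φ₁ x, Φ x) ∈ phaseSpace k := by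
  have hex : ∀ N : ℕ, ∃ G : SimpleGraph (Fin (N + 2)), starDensity 1 G ≠ Φ₁ x ∧
      ∀ v, |degR G v - relDeg (R (N + 2) ⌊x * ((N + 2 : ℕ) : ℝ)⌋₊) v| ≤ 2 := by
    intro N
    obtain ⟨G₁, G₂, hG₁, hG₂, hlt⟩ :=
      exists_graph_pair (R (N + 2) ⌊x * ((N + 2 : ℕ) : ℝ)⌋₊) (hR _ _)
    by_cases hne : starDensity 1 G₁ = Φ₁ x
    · exact ⟨G₂, (hne ▸ hlt).ne', hG₂⟩
    · exact ⟨G₁, hne, hG₁⟩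
  choose G hGne hG using hex
  have hy : Filter.Tendsto (fun N : ℕ => (⌊x * ((N + 2 : ℕ) : ℝ)⌋₊ : ℝ) / ((N + 2 : ℕ) : ℝ))
      Filter.atTop (nhds x) :=
    ((tendsto_nat_floor_mul_div_atTop hx0).comp tendsto_natCast_atTop_atTop).comp
      (Filter.tendsto_add_atTop_nat 2)
  have hM : ∀ N : ℕ, ⌊x * ((N + 2 : ℕ) : ℝ)⌋₊ ≤ N + 2 := fun N =>
    Nat.floor_le_of_le (mul_le_of_le_one_left (Nat.cast_nonneg _) hx1)
  have hlim : ∀ (j : ℕ) (Ψ : ℝ → ℝ), Continuous Ψ →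
      (∀ n M : ℕ, 0 < n → M ≤ n → (∑ v, relDeg (R n M) v ^ j) / (n : ℝ) ^ (j + 1) = Ψ (M / n)) →
      Filter.Tendsto (fun N => starDensity j (G N)) Filter.atTop (nhds (Ψ x)) := by
    intro j Ψ hΨ hsum
    have h3 := (hΨ.tendsto x).comp hy
    have h4 : Filter.Tendsto (fun N : ℕ => 2 * (j : ℝ) / ((N + 2 : ℕ) : ℝ)) Filter.atTop (nhds 0) :=
      (tendsto_const_div_atTop_nhds_zero_nat (2 * (j : ℝ))).comp (Filter.tendsto_add_atTop_nat 2)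
    refine tendsto_of_tendsto_of_dist h3 (squeeze_zero (fun _ => dist_nonneg) (fun N => ?_) h4)
    rw [dist_comm, Real.dist_eq, Function.comp_apply, ← hsum (N + 2) _ (by omega) (hM N),
      starDensity_eq]
    exact sum_pow_near j _ _ (degR_nonneg _) (degR_le _) (relDeg_nonneg _) (relDeg_le _) (hG N)
      (by omega)
  have hpair := (hlim 1 Φ₁ hΦ₁ h₁).prodMk_nhds (hlim k Φ hΦ h)
  refine accPt_iff_nhds.2 fun U hU => ?_
  obtain ⟨N, hN⟩ := (hpair.eventually hU).exists
  exact ⟨_, ⟨hN, N + 2, by omega, G N, rfl⟩, fun heq => hGne N (Prod.ext_iff.1 heq).1⟩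

theorem sum_ite_lt_ite {n M : ℕ} (hM : M ≤ n) (a b : ℝ) :
    ∑ v : Fin n, (if (v : ℕ) < M then a else b) = M * a + (n - M) * b := by
  have h1 := sum_ite_lt_const hM (a - b)
  have h2 : ∀ v : Fin n, (if (v : ℕ) < M then a else b) = (if (v : ℕ) < M then a - b else 0) + b := by
    intro v; split_ifs <;> ring
  rw [Finset.sum_congr rfl fun v _ => h2 v, Finset.sum_add_distrib, h1]
  simp
  ring

theorem clique_mem_phaseSpace (k : ℕ) (hk : k ≠ 0) {x : ℝ} (hx0 : 0 ≤ x) (hx1 : x ≤ 1) :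
    (x ^ 2, x ^ (k + 1)) ∈ phaseSpace k := by
  have h : ∀ j : ℕ, j ≠ 0 → ∀ n M : ℕ, 0 < n → M ≤ n →
      (∑ v : Fin n, relDeg (fun v w : Fin n => (v : ℕ) < M ∧ (w : ℕ) < M) v ^ j) / (n : ℝ) ^ (j + 1) =
        ((M : ℝ) / n) ^ (j + 1) := by
    intro j hj n M hn hM
    have hD : ∀ v : Fin n, relDeg (fun v w : Fin n => (v : ℕ) < M ∧ (w : ℕ) < M) v ^ j =
        if (v : ℕ) < M then (M : ℝ) ^ j else 0 := by
      intro v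
      by_cases hv : (v : ℕ) < M
      · have := sum_ite_lt_const hM 1
        simp only [relDeg, hv, true_and, if_true]
        congr 1
        simpa using this
      · simp [relDeg, hv, hj]
    rw [Finset.sum_congr rfl fun v _ => hD v, sum_ite_lt_const hM, div_pow]
    ring
  exact mem_phaseSpace_of_relations k (fun n M v w => (v : ℕ) < M ∧ (w : ℕ) < M)
    (fun _ _ _ _ h => h.symm) (fun y => y ^ 2) (fun y => y ^ (k + 1)) (by fun_prop) (by fun_prop)
    (h 1 one_ne_zero) (h k hk) hx0 hx1

theorem anticlique_mem_phaseSpace (k : ℕ) {x : ℝ} (hx0 : 0 ≤ x) (hx1 : x ≤ 1) :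
    (x * (2 - x), x + (1 - x) * x ^ k) ∈ phaseSpace k := by
  have h : ∀ j : ℕ, ∀ n M : ℕ, 0 < n → M ≤ n →
      (∑ v : Fin n, relDeg (fun v w : Fin n => (v : ℕ) < M ∨ (w : ℕ) < M) v ^ j) / (n : ℝ) ^ (j + 1) =
        (M : ℝ) / n + (1 - (M : ℝ) / n) * ((M : ℝ) / n) ^ j := by
    intro j n M hn hM
    have hD : ∀ v : Fin n, relDeg (fun v w : Fin n => (v : ℕ) < M ∨ (w : ℕ) < M) v ^ j =
        if (v : ℕ) < M then (n : ℝ) ^ j else (M : ℝ) ^ j := by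
      intro v
      by_cases hv : (v : ℕ) < M
      · simp [relDeg, hv]
      · have := sum_ite_lt_const hM 1
        simp only [relDeg, hv, false_or, if_false]
        congr 1
        simpa using this
    have hn' : (n : ℝ) ≠ 0 := by exact_mod_cast hn.ne'
    rw [Finset.sum_congr rfl fun v _ => hD v, sum_ite_lt_ite hM, div_pow]
    field_simp
    ring
  have := mem_phaseSpace_of_relations k (fun n M v w => (v : ℕ) < M ∨ (w : ℕ) < M)
    (fun _ _ _ _ h => h.symm) (fun y => y + (1 - y) * y ^ 1) (fun y => y + (1 - y) * y ^ k)
    (by fun_prop) (by fun_prop) (h 1) (h k) hx0 hx1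
  convert this using 2
  ring

theorem regular_mem_phaseSpace (k : ℕ) {x : ℝ} (hx0 : 0 ≤ x) (hx1 : x ≤ 1) :
    (x, x ^ k) ∈ phaseSpace k := by
  have h : ∀ j : ℕ, ∀ n M : ℕ, 0 < n → M ≤ n →
      (∑ v : Fin n, relDeg (fun v w : Fin n => ((v + w : Fin n) : ℕ) < M) v ^ j) /
        (n : ℝ) ^ (j + 1) = ((M : ℝ) / n) ^ j := by
    intro j n M hn hM
    have : NeZero n := ⟨hn.ne'⟩
    have hD : ∀ v : Fin n, relDeg (fun v w : Fin n => ((v + w : Fin n) : ℕ) < M) v = M := by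
      intro v
      have h1 := sum_ite_lt_const hM 1
      rw [← Equiv.sum_comp (Equiv.addLeft v)] at h1
      rw [mul_one] at h1
      rw [← h1, relDeg]
      refine Finset.sum_congr rfl fun w _ => ?_
      rw [Equiv.coe_addLeft]
      by_cases h : ((v + w : Fin n) : ℕ) < M <;> simp [h]
    have hn' : (n : ℝ) ≠ 0 := by exact_mod_cast hn.ne'
    simp only [hD, Finset.sum_const, Finset.card_univ, Fintype.card_fin, nsmul_eq_mul, div_pow]
    field_simp
    ring
  have := mem_phaseSpace_of_relations k (fun n M v w => ((v + w : Fin n) : ℕ) < M)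
    (fun _ _ v w h => by rwa [add_comm]) (fun y => y ^ 1) (fun y => y ^ k)
    (by fun_prop) (by fun_prop) (h 1) (h k) hx0 hx1
  simpa using this

theorem mainTheorem5 (k : ℕ) (hk₂ : 2 ≤ k) (hk₃₀ : k ≤ 30) :
    (∃ ε₀ ∈ Set.Ioo (0 : ℝ) 1,
      (∀ ε ∈ Set.Ioo (0 : ℝ) 1, anticliqueBranch k ε = cliqueBranch k ε ↔ ε = ε₀) ∧
      (∀ ε ∈ Set.Icc (0 : ℝ) 1,
        (ε ≤ ε₀ → IsGreatest (phaseSlice k ε) (anticliqueBranch k ε)) ∧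
        (ε₀ ≤ ε → IsGreatest (phaseSlice k ε) (cliqueBranch k ε))) ∧
      (k = 2 → ε₀ = 1 / 2) ∧
      (k = 3 → ε₀ = 3 / 4)) ∧
    (∀ ε ∈ Set.Icc (0 : ℝ) 1, IsLeast (phaseSlice k ε) (ε ^ k)) := by
  obtain ⟨m, rfl⟩ : ∃ m, k = m + 2 := ⟨k - 2, by omega⟩
  obtain ⟨ε₀, hε₀, huniq, hA, hC⟩ := exists_branch_crossing m
  refine ⟨⟨ε₀, hε₀, huniq, fun ε hε => ⟨fun h => ⟨?_, fun τ hτ => ?_⟩, fun h => ⟨?_, fun τ hτ => ?_⟩⟩,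
    fun h => ?_, fun h => ?_⟩, fun ε hε => ⟨?_, fun τ hτ => ?_⟩⟩
  · have := anticlique_mem_phaseSpace (m + 2) (antiRoot_nonneg hε.1) (antiRoot_le_one ε)
    rwa [antiRoot_mul hε.2, ← anticliqueBranch_eq' m hε.2] at this
  · exact (le_max_of_mem_phaseSpace m hτ).trans_eq (max_eq_left (hA ε hε h))
  · have := clique_mem_phaseSpace (m + 2) (by omega) (Real.sqrt_nonneg ε)
      (Real.sqrt_le_one.2 hε.2)
    rwa [Real.sq_sqrt hε.1, ← cliqueBranch_eq (m + 2) hε.1] at this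
  · exact (le_max_of_mem_phaseSpace m hτ).trans_eq (max_eq_right (hC ε hε h))
  · obtain rfl : m = 0 := by omega
    exact ((huniq (1 / 2) (by norm_num)).1 branch_two_half).symm
  · obtain rfl : m = 1 := by omega
    exact ((huniq (3 / 4) (by norm_num)).1 branch_three_three_quarters).symm
  · exact regular_mem_phaseSpace (m + 2) hε.1 hε.2
  · exact pow_le_of_mem_phaseSpace (m + 1) hτ
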